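/- **Ordered groupoids as double categories.** An ordered groupoid is a small groupoid $\mathcal G$ with a partial order on its arrows, which restricts to its objects via the identity arrows, such that $a\le b$ implies $a^{-1}\le b^{-1}$; $a\le b$ and $c\le d$ imply $ac\le bd$ whenever both composites are defined; and for each $f\colon A\to B$ and $A'\le A$ there is a unique arrow $f|_{A'}$ with domain $A'$ and $f|_{A'}\le f$. It is regarded as a double category, i.e. an internal category in the category $\mathbf{Cat}$ of small categories: $\mathcal G_0$ is the poset of objects, $\mathcal G_1$ the poset of arrows (posets being viewed as categories), with the source, target, identity and composition maps of the groupoid. Order-preserving functors give double functors. **The ordered groupoid $\mathbf{GL}(\mathcal G)$.** The left-cancellative category $\mathbf L(\mathcal G)$ has the objects of $\mathcal G$; an arrow $A\to B$ is a pair consisting of an arrow $h\colon A\to B'$ of $\mathcal G$ and a relation $B'\le B$; the composite of $(h\colon A\to B',\,B'\le B)$ and $(k\colon B\to C',\,C'\le C)$ is $(k|_{B'}\,h\colon A\to C'',\,C''\le C)$. For a left-cancellative category $\mathcal C$, the ordered groupoid $\mathbf G(\mathcal C)$ has as objects the subobjects $[m\colon A\to B]$ in $\mathcal C$ and as arrows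 $[m]\to[n]$ the isomorphism classes $[m,n]$ of spans $B\xleftarrow{m}A\xrightarrow{n}C$; $[k,m]$ followed by $[m',n]$, where $m'h=m$ with $h$ an isomorphism, is $[k,nh]$; and $[m,n]\le[m',n']$ if and only if there is an arrow $h$ with $m=m'h$ and $n=n'h$. **The double functor $\kappa_{\mathcal G}$.** The order-preserving functor $\kappa_{\mathcal G}\colon\mathbf{GL}(\mathcal G)\to\mathcal G$ sends the object $[A\xrightarrow{h}B'\le B]$ to $B'$, and the arrow given by the span with legs $(h\colon A\to B',\,B'\le B)$ and $(k\colon A\to C',\,C'\le C)$ to $kh^{-1}\colon B'\to C'$. **Weak equivalences.** Let $\mathcal D$ be a category with finite limits. A morphism $p\colon E\to B$ of $\mathcal D$ is of effective descent if the pullback functor $p^*\colon\mathcal D/B\to\mathcal D/E$ is monadic. A functor $F\colon\mathbb C\to\mathbb D$ of internal categories in $\mathcal D$ is a weak equivalence if 1. (essentially surjective) the composite $\mathbb C_0\times_{\mathbb D_0}\mathbb D_1\xrightarrow{\pi_2}\mathbb D_1\xrightarrow{t}\mathbb D_0$, where the pullback is that of $F_0$ and the source map $s\colon\mathbb D_1\to\mathbb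 D_0$, is of effective descent in $\mathcal D$; and 2. (fully faithful) the square $$\begin{array}{ccc}\mathbb C_1&\xrightarrow{\;F_1\;}&\mathbb D_1\\ {\scriptstyle (s,t)}\big\downarrow&&\big\downarrow{\scriptstyle (s,t)}\\ \mathbb C_0\times\mathbb C_0&\xrightarrow{F_0\times F_0}&\mathbb D_0\times\mathbb D_0\end{array}$$ is a pullback. **Proposition.** For every ordered groupoid $\mathcal G$, the double functor $\kappa_{\mathcal G}\colon\mathbf{GL}(\mathcal G)\to\mathcal G$ is a weak equivalence of double categories, that is, of internal categories in $\mathbf{Cat}$. -/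

import Mathlib

open CategoryTheory CategoryTheory.Limits

universe u v w

noncomputable section

/-! ### Internal categories, effective descent, weak equivalences -/

/-- An internal category in `D`. Composition is written in diagrammatic order: on a composable pair
`(f, g)`, i.e. `t f = s g`, the arrow `m (f, g)` is "`f`, then `g`". The object `C₂` with its
projections is a pullback of `t` and `s`. -/
structure InternalCategory (D : Type v) [Category.{w} D] where
  C₀ : D
  C₁ : D
  C₂ : D
  s : C₁ ⟶ C₀
  t : C₁ ⟶ C₀
  e : C₀ ⟶ C₁
  p₁ : C₂ ⟶ C₁
  p₂ : C₂ ⟶ C₁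
  isPullback : IsPullback p₁ p₂ t s
  m : C₂ ⟶ C₁
  e_s : e ≫ s = 𝟙 C₀
  e_t : e ≫ t = 𝟙 C₀
  m_s : m ≫ s = p₁ ≫ s
  m_t : m ≫ t = p₂ ≫ t
  e_m : ∀ {T : D} (f : T ⟶ C₁) (h : (f ≫ s ≫ e) ≫ t = f ≫ s),
    isPullback.lift (f ≫ s ≫ e) f h ≫ m = f
  m_e : ∀ {T : D} (f : T ⟶ C₁) (h : f ≫ t = (f ≫ t ≫ e) ≫ s),
    isPullback.lift f (f ≫ t ≫ e) h ≫ m = f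
  assoc : ∀ {T : D} (f g k : T ⟶ C₁) (hfg : f ≫ t = g ≫ s) (hgk : g ≫ t = k ≫ s)
    (h₁ : (isPullback.lift f g hfg ≫ m) ≫ t = k ≫ s)
    (h₂ : f ≫ t = (isPullback.lift g k hgk ≫ m) ≫ s),
    isPullback.lift (isPullback.lift f g hfg ≫ m) k h₁ ≫ m =
      isPullback.lift f (isPullback.lift g k hgk ≫ m) h₂ ≫ m

/-- A functor between internal categories in `D`. -/
structure InternalFunctor {D : Type v} [Category.{w} D] (A B : InternalCategory D) where
  F₀ : A.C₀ ⟶ B.C₀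
  F₁ : A.C₁ ⟶ B.C₁
  map_s : F₁ ≫ B.s = A.s ≫ F₀
  map_t : F₁ ≫ B.t = A.t ≫ F₀
  map_e : A.e ≫ F₁ = F₀ ≫ B.e
  map_m : ∀ h : (A.p₁ ≫ F₁) ≫ B.t = (A.p₂ ≫ F₁) ≫ B.s,
    A.m ≫ F₁ = B.isPullback.lift (A.p₁ ≫ F₁) (A.p₂ ≫ F₁) h ≫ B.m

/-- A morphism `p : E ⟶ B` is of effective descent if the pullback functor
`p^* : D/B ⥤ D/E` is monadic. -/
def IsEffectiveDescent {D : Type v} [Category.{w} D] [HasPullbacks D] {E B : D} (p : E ⟶ B) :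
    Prop :=
  (Monad.comparison (Over.mapPullbackAdj p)).IsEquivalence

namespace InternalFunctor

variable {D : Type v} [Category.{w} D] {A B : InternalCategory D}

/-- The composite `A₀ ×_{B₀} B₁ ⟶ B₁ ⟶ B₀` of the second projection and the target map
is of effective descent. -/
def IsEssentiallySurjective [HasPullbacks D] (F : InternalFunctor A B) : Prop :=
  IsEffectiveDescent (pullback.snd F.F₀ B.s ≫ B.t)

/-- The square with sides `F₁`, `(s, t)`, `(s, t)` and `F₀ × F₀` is a pullback. -/
def IsFullyFaithful [HasBinaryProducts D] (F : InternalFunctor A B) : Prop :=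
  IsPullback F.F₁ (prod.lift A.s A.t) (prod.lift B.s B.t) (prod.map F.F₀ F.F₀)

/-- A weak equivalence of internal categories. -/
def IsWeakEquivalence [HasPullbacks D] [HasBinaryProducts D] (F : InternalFunctor A B) : Prop :=
  F.IsEssentiallySurjective ∧ F.IsFullyFaithful

end InternalFunctor

/-! ### Ordered groupoids -/

/-- The type of all arrows of a small category, with their domains and codomains. -/
structure Ar (X : Type u) [Category.{u} X] : Type u where
  {dom : X}
  {cod : X}
  hom : dom ⟶ cod

/-- An ordered groupoid. -/
class OrderedGroupoid (X : Type u) extends Groupoid.{u} X where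
  arrowOrder : PartialOrder (Ar X)
  inv_le : ∀ {A B A' B' : X} {f : A ⟶ B} {f' : A' ⟶ B'},
    Ar.mk f ≤ Ar.mk f' → Ar.mk (Groupoid.inv f) ≤ Ar.mk (Groupoid.inv f')
  comp_le : ∀ {A B C A' B' C' : X} {f : A ⟶ B} {g : B ⟶ C} {f' : A' ⟶ B'} {g' : B' ⟶ C'},
    Ar.mk f ≤ Ar.mk f' → Ar.mk g ≤ Ar.mk g' → Ar.mk (f ≫ g) ≤ Ar.mk (f' ≫ g')
  restrict : ∀ {A B : X} (f : A ⟶ B) {A' : X}, Ar.mk (𝟙 A') ≤ Ar.mk (𝟙 A) →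
    ∃! g : (Σ B' : X, (A' ⟶ B')), Ar.mk g.2 ≤ Ar.mk f

instance {X : Type u} [OrderedGroupoid X] : PartialOrder (Ar X) := OrderedGroupoid.arrowOrder

/-- An ordered functor: a functor that preserves the order relation. -/
structure OrderedFunctor (X Y : Type u) [OrderedGroupoid X] [OrderedGroupoid Y] extends
    Functor X Y where
  monotone : ∀ {A B A' B' : X} {f : A ⟶ B} {f' : A' ⟶ B'},
    Ar.mk f ≤ Ar.mk f' → Ar.mk (map f) ≤ Ar.mk (map f')

/-- The order on the objects of an ordered groupoid, via the identity arrows. -/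
def ObLE {X : Type u} [OrderedGroupoid X] (A B : X) : Prop := Ar.mk (𝟙 A) ≤ Ar.mk (𝟙 B)

section

variable {X : Type u} [OrderedGroupoid X]

theorem ObLE.refl (A : X) : ObLE A A := le_refl (Ar.mk (𝟙 A))

theorem ObLE.trans {A B C : X} (h : ObLE A B) (k : ObLE B C) : ObLE A C := le_trans h k

theorem ObLE.antisymm {A B : X} (h : ObLE A B) (k : ObLE B A) : A = B :=
  congrArg Ar.dom (le_antisymm h k)

theorem obLE_dom {A B A' B' : X} {f : A ⟶ B} {f' : A' ⟶ B'} (h : Ar.mk f ≤ Ar.mk f') :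
    ObLE A A' := by
  have := OrderedGroupoid.comp_le h (OrderedGroupoid.inv_le h)
  simpa [ObLE] using this

theorem obLE_cod {A B A' B' : X} {f : A ⟶ B} {f' : A' ⟶ B'} (h : Ar.mk f ≤ Ar.mk f') :
    ObLE B B' := by
  have := OrderedGroupoid.comp_le (OrderedGroupoid.inv_le h) h
  simpa [ObLE] using this

/-- The codomain of the restriction `f|_{A'}`. -/
def resCod {A B : X} (f : A ⟶ B) {A' : X} (h : ObLE A' A) : X :=
  (OrderedGroupoid.restrict f h).choose.1

/-- The restriction `f|_{A'}`. -/
def res {A B : X} (f : A ⟶ B) {A' : X} (h : ObLE A' A) : A' ⟶ resCod f h :=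
  (OrderedGroupoid.restrict f h).choose.2

theorem res_le {A B : X} (f : A ⟶ B) {A' : X} (h : ObLE A' A) : Ar.mk (res f h) ≤ Ar.mk f :=
  (OrderedGroupoid.restrict f h).choose_spec.1

theorem res_unique {A B A' C C' : X} {f : A ⟶ B} (g : A' ⟶ C) (g' : A' ⟶ C')
    (hg : Ar.mk g ≤ Ar.mk f) (hg' : Ar.mk g' ≤ Ar.mk f) :
    (⟨C, g⟩ : Σ B' : X, (A' ⟶ B')) = ⟨C', g'⟩ :=
  (OrderedGroupoid.restrict f (obLE_dom hg)).unique hg hg'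

end

/-! ### The left-cancellative category of an ordered groupoid -/

/-- A category is left-cancellative if all its arrows are monomorphisms. -/
class LeftCancellative (C : Type u) [Category.{u} C] : Prop where
  mono : ∀ {A B : C} (f : A ⟶ B), Mono f

instance {C : Type u} [Category.{u} C] [LeftCancellative C] {A B : C} (f : A ⟶ B) : Mono f :=
  LeftCancellative.mono f

/-- The objects of `L(X)` are those of `X`. -/
structure LCat (X : Type u) : Type u where
  of : X

/-- An arrow `A ⟶ B` of `L(X)`: a formal composite of a horizontal arrow `A ⟶ mid` and
a vertical arrow `mid ≤ B`. -/
@[ext] structure LHom {X : Type u} [OrderedGroupoid X] (A B : LCat X) : Type u where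
  mid : X
  hom : A.of ⟶ mid
  le : ObLE mid B.of

section

variable {X : Type u} [OrderedGroupoid X]

theorem LHom.ext_sigma {A B : LCat X} {f g : LHom A B}
    (h : (⟨f.mid, f.hom⟩ : Σ B' : X, (A.of ⟶ B')) = ⟨g.mid, g.hom⟩) : f = g := by
  rcases f with ⟨m, f, hf⟩
  rcases g with ⟨n, g, hg⟩
  cases h
  rfl

/-- Composition in `L(X)`, by restriction. -/
def LHom.comp {A B C : LCat X} (f : LHom A B) (g : LHom B C) : LHom A C where
  mid := resCod g.hom f.le
  hom := f.hom ≫ res g.hom f.le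
  le := (obLE_cod (res_le g.hom f.le)).trans g.le

theorem LHom.comp_eq {A B C : LCat X} (f : LHom A B) (g : LHom B C) {D : X} (r : f.mid ⟶ D)
    (hr : Ar.mk r ≤ Ar.mk g.hom) :
    f.comp g = ⟨D, f.hom ≫ r, (obLE_cod hr).trans g.le⟩ := by
  apply LHom.ext_sigma
  have h := res_unique _ _ (res_le g.hom f.le) hr
  exact congrArg (fun q : (Σ B' : X, (f.mid ⟶ B')) =>
    (⟨q.1, f.hom ≫ q.2⟩ : Σ B' : X, (A.of ⟶ B'))) h

instance : Category.{u} (LCat X) where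
  Hom A B := LHom A B
  id A := ⟨A.of, 𝟙 A.of, ObLE.refl _⟩
  comp f g := f.comp g
  id_comp {A B} f := by
    rw [LHom.comp_eq _ f f.hom le_rfl]
    simp
  comp_id {A B} f := by
    refine (LHom.comp_eq f ⟨B.of, 𝟙 B.of, ObLE.refl _⟩ (𝟙 f.mid) f.le).trans ?_
    simp
  assoc {A B C D} f g h := by
    have e₁ : (f.comp g).comp h = _ := LHom.comp_eq _ _ _ (res_le h.hom (f.comp g).le)
    have h₁ := res_le (res h.hom g.le) (obLE_cod (res_le g.hom f.le))
    have e : (⟨_, res h.hom (f.comp g).le⟩ : Σ B' : X, (resCod g.hom f.le ⟶ B')) = _ :=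
      res_unique _ _ (res_le h.hom (f.comp g).le) (h₁.trans (res_le h.hom g.le))
    have h₂ : Ar.mk (res g.hom f.le ≫ res h.hom (f.comp g).le) ≤ Ar.mk (g.comp h).hom := by
      refine OrderedGroupoid.comp_le (res_le _ _) (le_trans (le_of_eq ?_) h₁)
      exact congrArg (fun q : (Σ B' : X, (resCod g.hom f.le ⟶ B')) => Ar.mk q.2) e
    have e₂ : f.comp (g.comp h) = _ := LHom.comp_eq _ _ _ h₂
    rw [e₁, e₂]
    apply LHom.ext_sigma
    simp [LHom.comp]

theorem LHom.hom_ext_sigma {A B : LCat X} {f g : A ⟶ B}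
    (h : (⟨LHom.mid f, LHom.hom f⟩ : Σ B' : X, (A.of ⟶ B')) = ⟨LHom.mid g, LHom.hom g⟩) : f = g :=
  LHom.ext_sigma h

theorem LHom.comp_def {A B C : LCat X} (f : A ⟶ B) (g : B ⟶ C) : f ≫ g = LHom.comp f g := rfl

instance : LeftCancellative (LCat X) where
  mono {B C} k := by
    refine ⟨fun {A} f g h => ?_⟩
    have hs : (⟨_, LHom.hom f ≫ res (LHom.hom k) (LHom.le f)⟩ : Σ B' : X, (A.of ⟶ B')) =
        ⟨_, LHom.hom g ≫ res (LHom.hom k) (LHom.le g)⟩ :=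
      congrArg (fun q : LHom A C => (⟨q.mid, q.hom⟩ : Σ B' : X, (A.of ⟶ B'))) h
    have key : ∀ {m n P Q : X} (a : A.of ⟶ m) (b : A.of ⟶ n) (r : m ⟶ P) (r' : n ⟶ Q),
        Ar.mk r ≤ Ar.mk (LHom.hom k) → Ar.mk r' ≤ Ar.mk (LHom.hom k) →
        (⟨P, a ≫ r⟩ : Σ B' : X, (A.of ⟶ B')) = ⟨Q, b ≫ r'⟩ →
        (⟨m, a⟩ : Σ B' : X, (A.of ⟶ B')) = ⟨n, b⟩ := by
      intro m n P Q a b r r' hr hr' e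
      obtain ⟨rfl, e⟩ := Sigma.mk.inj e
      have e := eq_of_heq e
      have e' := res_unique _ _ (OrderedGroupoid.inv_le hr) (OrderedGroupoid.inv_le hr')
      obtain ⟨rfl, e'⟩ := Sigma.mk.inj e'
      have e' : r = r' := by
        have e'' := eq_of_heq e'
        rw [Groupoid.inv_eq_inv, Groupoid.inv_eq_inv] at e''
        exact IsIso.inv_eq_inv.1 e''
      subst e'
      rw [cancel_mono] at e
      rw [e]
    exact LHom.hom_ext_sigma (key _ _ _ _ (res_le _ _) (res_le _ _) hs)

end

/-! ### The ordered groupoid of a left-cancellative category -/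

/-- The objects of `G(C)`: subobjects in `C`. -/
@[ext] structure GCat (C : Type u) [Category.{u} C] : Type u where
  base : C
  sub : Subobject base

/-- A span `B ⟵ apex ⟶ B'` in `C`. -/
structure SpanRep {C : Type u} [Category.{u} C] (B B' : C) : Type u where
  {apex : C}
  left : apex ⟶ B
  right : apex ⟶ B'

/-- Two spans are equivalent if there is an isomorphism of their apices compatible with the legs. -/
instance SpanRep.setoid {C : Type u} [Category.{u} C] (B B' : C) : Setoid (SpanRep B B') where
  r p q := ∃ h : p.apex ≅ q.apex, h.hom ≫ q.left = p.left ∧ h.hom ≫ q.right = p.right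
  iseqv :=
    { refl := fun p => ⟨Iso.refl _, by simp⟩
      symm := by
        rintro p q ⟨h, h₁, h₂⟩
        exact ⟨h.symm, by simp [← h₁, ← h₂]⟩
      trans := by
        rintro p q r ⟨h, h₁, h₂⟩ ⟨k, k₁, k₂⟩
        exact ⟨h ≪≫ k, by simp [← h₁, ← h₂, k₁, k₂]⟩ }

/-- Equivalence classes `[m, n]` of spans. -/
def SpanClass {C : Type u} [Category.{u} C] (B B' : C) : Type u :=
  Quotient (SpanRep.setoid B B')

namespace SpanClass

variable {C : Type u} [Category.{u} C]

/-- The class `[m, n]`. -/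
def mk {A B B' : C} (m : A ⟶ B) (n : A ⟶ B') : SpanClass B B' := Quotient.mk _ ⟨m, n⟩

theorem mk_eq_mk {A A' B B' : C} {m : A ⟶ B} {n : A ⟶ B'} {m' : A' ⟶ B} {n' : A' ⟶ B'} :
    mk m n = mk m' n' ↔ ∃ h : A ≅ A', h.hom ≫ m' = m ∧ h.hom ≫ n' = n :=
  Quotient.eq (r := SpanRep.setoid B B')

theorem ind {B B' : C} {P : SpanClass B B' → Prop}
    (h : ∀ {A : C} (m : A ⟶ B) (n : A ⟶ B'), P (mk m n)) (q : SpanClass B B') : P q :=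
  Quotient.ind (fun p => h p.left p.right) q

/-- `[m, n]⁻¹ = [n, m]`. -/
def symm {B B' : C} (q : SpanClass B B') : SpanClass B' B :=
  Quotient.lift (fun p : SpanRep B B' => mk p.right p.left)
    (by
      rintro p q ⟨h, h₁, h₂⟩
      exact mk_eq_mk.2 ⟨h, h₂, h₁⟩) q

@[simp] theorem symm_mk {A B B' : C} (m : A ⟶ B) (n : A ⟶ B') : (mk m n).symm = mk n m := rfl

/-- The order on arrows of `G(C)`: `[m, n] ≤ [m', n']` if there is an arrow `h` of `C` with
`m = m' h` and `n = n' h`. -/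
def le {B B' : C} (q q' : SpanClass B B') : Prop :=
  Quotient.liftOn₂ q q'
    (fun p p' => ∃ h : p.apex ⟶ p'.apex, h ≫ p'.left = p.left ∧ h ≫ p'.right = p.right)
    (by
      rintro a b a' b' ⟨h, h₁, h₂⟩ ⟨k, k₁, k₂⟩
      refine propext ⟨?_, ?_⟩
      · rintro ⟨x, x₁, x₂⟩
        exact ⟨h.inv ≫ x ≫ k.hom, by simp [k₁, x₁, ← h₁], by simp [k₂, x₂, ← h₂]⟩
      · rintro ⟨x, x₁, x₂⟩
        exact ⟨h.hom ≫ x ≫ k.inv, by simp [← k₁, x₁, h₁], by simp [← k₂, x₂, h₂]⟩)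

theorem mk_le_mk {A A' B B' : C} {m : A ⟶ B} {n : A ⟶ B'} {m' : A' ⟶ B} {n' : A' ⟶ B'} :
    le (mk m n) (mk m' n') ↔ ∃ h : A ⟶ A', h ≫ m' = m ∧ h ≫ n' = n := Iff.rfl

/-- A representative of a class of spans. -/
def rep {B B' : C} (q : SpanClass B B') : SpanRep B B' := Quotient.out q

theorem mk_rep {B B' : C} (q : SpanClass B B') : mk q.rep.left q.rep.right = q := Quotient.out_eq q

variable [LeftCancellative C]

instance (B B' : C) : PartialOrder (SpanClass B B') where
  le := le
  le_refl q := by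
    induction q using ind with
    | h m n => exact mk_le_mk.2 ⟨𝟙 _, by simp⟩
  le_trans p q r := by
    induction p using ind
    induction q using ind
    induction r using ind
    rintro ⟨h, h₁, h₂⟩ ⟨k, k₁, k₂⟩
    exact mk_le_mk.2 ⟨h ≫ k, by simp_all, by simp_all⟩
  le_antisymm p q := by
    induction p using ind with
    | h m n =>
    induction q using ind with
    | h m' n' =>
    rintro ⟨h, h₁, h₂⟩ ⟨k, k₁, k₂⟩
    dsimp at h h₁ h₂ k k₁ k₂
    refine mk_eq_mk.2 ⟨⟨h, k, ?_, ?_⟩, h₁, h₂⟩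
    · rw [← cancel_mono m]; simp [k₁, h₁]
    · rw [← cancel_mono m']; simp [k₁, h₁]

/-- The domain `[m]` of `[m, n]`. -/
def dom {B B' : C} (q : SpanClass B B') : Subobject B :=
  Quotient.lift (fun p : SpanRep B B' => Subobject.mk p.left)
    (by
      rintro p q ⟨h, h₁, h₂⟩
      exact Subobject.mk_eq_mk_of_comm _ _ h h₁) q

/-- The codomain `[n]` of `[m, n]`. -/
def cod {B B' : C} (q : SpanClass B B') : Subobject B' :=
  Quotient.lift (fun p : SpanRep B B' => Subobject.mk p.right)
    (by
      rintro p q ⟨h, h₁, h₂⟩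
      exact Subobject.mk_eq_mk_of_comm _ _ h h₂) q

@[simp] theorem dom_mk {A B B' : C} (m : A ⟶ B) (n : A ⟶ B') :
    (mk m n).dom = Subobject.mk m := rfl

@[simp] theorem cod_mk {A B B' : C} (m : A ⟶ B) (n : A ⟶ B') :
    (mk m n).cod = Subobject.mk n := rfl

@[simp] theorem dom_symm {B B' : C} (q : SpanClass B B') : q.symm.dom = q.cod := by
  induction q using ind
  rfl

@[simp] theorem cod_symm {B B' : C} (q : SpanClass B B') : q.symm.cod = q.dom := by
  induction q using ind
  rfl

theorem exists_iso {A A' B : C} {m : A ⟶ B} {m' : A' ⟶ B}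
    (h : Subobject.mk m = Subobject.mk m') : ∃ k : A ≅ A', k.hom ≫ m' = m :=
  ⟨Subobject.isoOfMkEqMk _ _ h, by simp⟩

/-- For composable `p` and `q` with representatives `(k, m)` and `(m', n)`, there is an
isomorphism `h` with `m' h = m`. -/
theorem exists_middle {B B' B'' : C} {p : SpanClass B B'} {q : SpanClass B' B''}
    (h : p.cod = q.dom) : ∃ k : p.rep.apex ≅ q.rep.apex, k.hom ≫ q.rep.left = p.rep.right := by
  apply exists_iso
  rw [← mk_rep p, ← mk_rep q] at h
  exact h

/-- The composite `[k, n h]` of `[k, m]` and `[m', n]`, where `m' h = m`. -/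
def comp {B B' B'' : C} (p : SpanClass B B') (q : SpanClass B' B'') (h : p.cod = q.dom) :
    SpanClass B B'' :=
  mk p.rep.left ((exists_middle h).choose.hom ≫ q.rep.right)

theorem comp_mk {A A' B B' B'' : C} (k : A ⟶ B) (m : A ⟶ B') (m' : A' ⟶ B') (n : A' ⟶ B'')
    (h : A ≅ A') (w : h.hom ≫ m' = m) (hc : (mk k m).cod = (mk m' n).dom) :
    comp (mk k m) (mk m' n) hc = mk k (h.hom ≫ n) := by
  have hx := (exists_middle hc).choose_spec
  obtain ⟨a, a₁, a₂⟩ := mk_eq_mk.1 (mk_rep (mk k m))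
  obtain ⟨b, b₁, b₂⟩ := mk_eq_mk.1 (mk_rep (mk m' n))
  refine mk_eq_mk.2 ⟨a, a₁, ?_⟩
  rw [← b₂, ← Category.assoc, ← Category.assoc]
  congr 1
  rw [← cancel_mono m']
  simp only [Category.assoc]
  rw [w, a₂, b₁, hx]

/-- Composable classes have representatives that share the middle leg. -/
theorem exists_rep {B B' B'' : C} (p : SpanClass B B') (q : SpanClass B' B'')
    (h : p.cod = q.dom) :
    ∃ (A : C) (k : A ⟶ B) (m : A ⟶ B') (n : A ⟶ B''), p = mk k m ∧ q = mk m n := by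
  induction p using ind with
  | h k m =>
  induction q using ind with
  | h m' n =>
  obtain ⟨i, hi⟩ := exists_iso h
  exact ⟨_, k, m, i.hom ≫ n, rfl, mk_eq_mk.2 ⟨i.symm, (Iso.inv_comp_eq i).2 hi.symm, by simp⟩⟩

theorem comp_mk_same {A B B' B'' : C} (k : A ⟶ B) (m : A ⟶ B') (n : A ⟶ B'')
    (hc : (mk k m).cod = (mk m n).dom) : comp (mk k m) (mk m n) hc = mk k n := by
  rw [comp_mk k m m n (Iso.refl _) (by simp)]
  simp

end SpanClass

section

variable {C : Type u} [Category.{u} C] [LeftCancellative C]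

open SpanClass

/-- Horizontal arrows of `G(C)`. -/
@[ext] structure GHom (X Y : GCat C) : Type u where
  span : SpanClass X.base Y.base
  dom_eq : span.dom = X.sub
  cod_eq : span.cod = Y.sub

/-- The identity `[m, m]` of `[m]`. -/
def GHom.id (X : GCat C) : GHom X X where
  span := SpanClass.mk X.sub.arrow X.sub.arrow
  dom_eq := by simp
  cod_eq := by simp

theorem GHom.exists_rep₂ {X Y Z : GCat C} (p : GHom X Y) (q : GHom Y Z) :
    ∃ (A : C) (k : A ⟶ X.base) (m : A ⟶ Y.base) (n : A ⟶ Z.base),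
      p.span = SpanClass.mk k m ∧ q.span = SpanClass.mk m n :=
  exists_rep _ _ (p.cod_eq.trans q.dom_eq.symm)

/-- Composition of horizontal arrows of `G(C)`. -/
def GHom.comp {X Y Z : GCat C} (p : GHom X Y) (q : GHom Y Z) : GHom X Z where
  span := p.span.comp q.span (p.cod_eq.trans q.dom_eq.symm)
  dom_eq := by
    obtain ⟨A, k, m, n, hp, hq⟩ := p.exists_rep₂ q
    have := p.dom_eq
    simp only [hp, hq, comp_mk_same] at this ⊢
    exact this
  cod_eq := by
    obtain ⟨A, k, m, n, hp, hq⟩ := p.exists_rep₂ q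
    have := q.cod_eq
    simp only [hp, hq, comp_mk_same] at this ⊢
    exact this

theorem GHom.comp_span {X Y Z : GCat C} (p : GHom X Y) (q : GHom Y Z) {A : C} {k : A ⟶ X.base}
    {m : A ⟶ Y.base} {n : A ⟶ Z.base} (hp : p.span = SpanClass.mk k m) (hq : q.span = SpanClass.mk m n) :
    (p.comp q).span = SpanClass.mk k n := by
  simp only [GHom.comp, hp, hq, comp_mk_same]

theorem GHom.id_span (X : GCat C) {A : C} {m : A ⟶ X.base} (h : Subobject.mk m = X.sub) :
    (GHom.id X).span = SpanClass.mk m m := by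
  obtain ⟨k, hk⟩ := exists_iso (h.trans (Subobject.mk_arrow X.sub).symm)
  exact mk_eq_mk.2 ⟨k.symm, by simp [← hk], by simp [← hk]⟩

theorem GHom.exists_rep₁ {X Y : GCat C} (p : GHom X Y) :
    ∃ (A : C) (k : A ⟶ X.base) (m : A ⟶ Y.base),
      p.span = SpanClass.mk k m ∧ Subobject.mk k = X.sub ∧ Subobject.mk m = Y.sub := by
  rcases p with ⟨p, h₁, h₂⟩
  induction p using SpanClass.ind with
  | h k m => exact ⟨_, k, m, rfl, h₁, h₂⟩

/-- The inverse of a horizontal arrow of `G(C)`. -/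
def GHom.inv {X Y : GCat C} (p : GHom X Y) : GHom Y X where
  span := p.span.symm
  dom_eq := by simp [p.cod_eq]
  cod_eq := by simp [p.dom_eq]

theorem GHom.inv_span {X Y : GCat C} (p : GHom X Y) {A : C} {k : A ⟶ X.base} {m : A ⟶ Y.base}
    (h : p.span = SpanClass.mk k m) : p.inv.span = SpanClass.mk m k := congrArg SpanClass.symm h

/-- The groupoid of horizontal arrows of `G(C)`. -/
instance : Groupoid.{u} (GCat C) where
  Hom := GHom
  id := GHom.id
  comp := GHom.comp
  inv := GHom.inv
  id_comp p := by
    obtain ⟨A, k, m, hp, hk, hm⟩ := p.exists_rep₁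
    apply GHom.ext
    rw [GHom.comp_span _ _ (GHom.id_span _ hk) hp, hp]
  comp_id p := by
    obtain ⟨A, k, m, hp, hk, hm⟩ := p.exists_rep₁
    apply GHom.ext
    rw [GHom.comp_span _ _ hp (GHom.id_span _ hm), hp]
  assoc p q r := by
    obtain ⟨A, k, m, n, hp, hq⟩ := p.exists_rep₂ q
    obtain ⟨A', m', n', l', hq', hr⟩ := q.exists_rep₂ r
    obtain ⟨i, hi₁, hi₂⟩ := mk_eq_mk.1 (hq.symm.trans hq')
    have hr' : r.span = SpanClass.mk n (i.hom ≫ l') := by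
      rw [hr]
      exact mk_eq_mk.2 ⟨i.symm, by simp [← hi₂], by simp⟩
    apply GHom.ext
    rw [GHom.comp_span _ _ (GHom.comp_span _ _ hp hq) hr',
      GHom.comp_span _ _ hp (GHom.comp_span _ _ hq hr')]
  inv_comp p := by
    obtain ⟨A, k, m, hp, hk, hm⟩ := p.exists_rep₁
    apply GHom.ext
    rw [GHom.comp_span (GHom.inv p) p (GHom.inv_span p hp) hp, GHom.id_span _ hm]
  comp_inv p := by
    obtain ⟨A, k, m, hp, hk, hm⟩ := p.exists_rep₁
    apply GHom.ext
    rw [GHom.comp_span p (GHom.inv p) hp (GHom.inv_span p hp), GHom.id_span _ hk]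

/-- An arrow of `G(C)` is determined by its class of spans. -/
def arToSpan (f : Ar (GCat C)) : Σ P : C × C, SpanClass P.1 P.2 :=
  ⟨(f.dom.base, f.cod.base), GHom.span f.hom⟩

theorem arToSpan_injective : Function.Injective (arToSpan (C := C)) := by
  rintro @⟨⟨B, S⟩, ⟨B', S'⟩, ⟨f, hf, hf'⟩⟩ @⟨⟨D, T⟩, ⟨D', T'⟩, ⟨g, hg, hg'⟩⟩ h
  simp only [arToSpan, Sigma.mk.injEq, Prod.mk.injEq] at h
  obtain ⟨⟨rfl, rfl⟩, h⟩ := h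
  obtain rfl := eq_of_heq h
  change f.dom = S at hf
  change f.cod = S' at hf'
  change f.dom = T at hg
  change f.cod = T' at hg'
  obtain rfl : S = T := hf.symm.trans hg
  obtain rfl : S' = T' := hf'.symm.trans hg'
  rfl

theorem arToSpan_le {X Y X' Y' : GCat C} {f : X ⟶ Y} {f' : X' ⟶ Y'}
    (h : arToSpan (Ar.mk f) ≤ arToSpan (Ar.mk f')) : X.base = X'.base ∧ Y.base = Y'.base := by
  obtain ⟨h, -⟩ := Sigma.le_def.1 h
  exact Prod.mk.inj h

theorem arToSpan_le_iff {B B' : C} {S T : Subobject B} {S' T' : Subobject B'}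
    {f : (⟨B, S⟩ : GCat C) ⟶ ⟨B', S'⟩} {f' : (⟨B, T⟩ : GCat C) ⟶ ⟨B', T'⟩} :
    arToSpan (Ar.mk f) ≤ arToSpan (Ar.mk f') ↔ GHom.span f ≤ GHom.span f' :=
  Sigma.mk_le_mk_iff (i := (B, B'))

/-- The ordered groupoid `G(C)`. -/
instance : OrderedGroupoid (GCat C) where
  arrowOrder := PartialOrder.lift arToSpan arToSpan_injective
  inv_le := by
    rintro ⟨B, S⟩ ⟨B', S'⟩ ⟨D, T⟩ ⟨D', T'⟩ f f' h
    obtain ⟨h₁, h₂⟩ := arToSpan_le h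
    dsimp only at h₁ h₂
    subst h₁ h₂
    refine arToSpan_le_iff.2 ?_
    replace h := arToSpan_le_iff.1 h
    obtain ⟨A, k, m, hf, -, -⟩ := GHom.exists_rep₁ f
    obtain ⟨A', k', m', hf', -, -⟩ := GHom.exists_rep₁ f'
    change SpanClass.symm (GHom.span f) ≤ SpanClass.symm (GHom.span f')
    rw [hf, hf'] at h ⊢
    obtain ⟨x, hx₁, hx₂⟩ := mk_le_mk.1 h
    exact mk_le_mk.2 ⟨x, hx₂, hx₁⟩
  comp_le := by
    rintro ⟨B, S⟩ ⟨B', S'⟩ ⟨B'', S''⟩ ⟨D, T⟩ ⟨D', T'⟩ ⟨D'', T''⟩ f g f' g' h h'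
    obtain ⟨h₁, h₂⟩ := arToSpan_le h
    obtain ⟨-, h₃⟩ := arToSpan_le h'
    dsimp only at h₁ h₂ h₃
    subst h₁ h₂ h₃
    refine arToSpan_le_iff.2 ?_
    replace h := arToSpan_le_iff.1 h
    replace h' := arToSpan_le_iff.1 h'
    obtain ⟨A, k, m, n, hf, hg⟩ := GHom.exists_rep₂ f g
    obtain ⟨A', k', m', n', hf', hg'⟩ := GHom.exists_rep₂ f' g'
    change (GHom.comp f g).span ≤ (GHom.comp f' g').span
    rw [GHom.comp_span _ _ hf hg, GHom.comp_span _ _ hf' hg']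
    rw [hf, hf'] at h
    rw [hg, hg'] at h'
    obtain ⟨x, hx₁, hx₂⟩ := mk_le_mk.1 h
    obtain ⟨y, hy₁, hy₂⟩ := mk_le_mk.1 h'
    obtain rfl : x = y := by rw [← cancel_mono m', hx₂, hy₁]
    exact mk_le_mk.2 ⟨x, hx₁, hy₂⟩
  restrict := by
    rintro ⟨B, S⟩ ⟨B', S'⟩ f ⟨D, T⟩ h
    obtain ⟨h₁, -⟩ := arToSpan_le h
    dsimp only at h₁
    subst h₁
    replace h := arToSpan_le_iff.1 h
    obtain ⟨A, k, m, hf, hk, hm⟩ := GHom.exists_rep₁ f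
    change (GHom.id (⟨D, T⟩ : GCat C)).span ≤ (GHom.id (⟨D, S⟩ : GCat C)).span at h
    dsimp only at k m hk hm
    rw [GHom.id_span _ (Subobject.mk_arrow T), GHom.id_span _ hk] at h
    obtain ⟨x, hx, -⟩ := mk_le_mk.1 h
    have hT : Subobject.mk (x ≫ k) = T := by simp [hx]
    refine ⟨⟨⟨B', Subobject.mk (x ≫ m)⟩, ⟨SpanClass.mk (x ≫ k) (x ≫ m), hT, rfl⟩⟩, ?_, ?_⟩
    · refine arToSpan_le_iff.2 ?_
      rw [hf]
      exact mk_le_mk.2 ⟨x, rfl, rfl⟩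
    · rintro ⟨⟨D', T'⟩, g⟩ hg
      obtain ⟨-, h₂⟩ := arToSpan_le hg
      dsimp only at h₂
      subst h₂
      replace hg := arToSpan_le_iff.1 hg
      obtain ⟨A', k', m', hg', hk', hm'⟩ := GHom.exists_rep₁ g
      dsimp only at k' m' hk' hm' hg'
      dsimp only at hg
      rw [hg', hf] at hg
      obtain ⟨y, hy₁, hy₂⟩ := mk_le_mk.1 hg
      obtain ⟨i, hi⟩ := exists_iso (hk'.trans hT.symm)
      obtain rfl : i.hom ≫ x = y := by
        rw [← cancel_mono k, hy₁, Category.assoc, hi]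
      have hT' : T' = Subobject.mk (x ≫ m) := by
        rw [← hm']
        exact Subobject.mk_eq_mk_of_comm _ _ i (by simpa using hy₂)
      subst hT'
      congr 1
      apply GHom.ext
      rw [hg']
      exact mk_eq_mk.2 ⟨i, hi, by simpa using hy₂⟩

end

/-! ### The ordered functor `κ` -/

section

variable {X : Type u} [OrderedGroupoid X]

theorem LHom.iso_eq {A B : LCat X} (i : A ≅ B) :
    ∃ k : A.of ⟶ B.of, i.hom = (⟨B.of, k, ObLE.refl _⟩ : LHom A B) := by
  have h : LHom.comp i.inv i.hom = ⟨B.of, 𝟙 B.of, ObLE.refl _⟩ := i.inv_hom_id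
  have h₁ : ObLE (LHom.comp i.inv i.hom).mid (LHom.mid i.hom) :=
    obLE_cod (res_le (LHom.hom i.hom) (LHom.le i.inv))
  rw [h] at h₁
  have h₂ : LHom.mid i.hom = B.of := (LHom.le i.hom).antisymm h₁
  generalize i.hom = f at h₂
  rcases f with ⟨m, f, hf⟩
  dsimp only at h₂
  subst h₂
  exact ⟨f, rfl⟩

theorem LHom.iso_comp {A A' B : LCat X} (i : A ≅ A') (g : A' ⟶ B) :
    ∃ k : A.of ⟶ A'.of, i.hom ≫ g = (⟨LHom.mid g, k ≫ LHom.hom g, LHom.le g⟩ : LHom A B) ∧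
      i.hom = (⟨A'.of, k, ObLE.refl _⟩ : LHom A A') := by
  obtain ⟨k, hk⟩ := LHom.iso_eq i
  refine ⟨k, ?_, hk⟩
  rw [hk, LHom.comp_def]
  exact LHom.comp_eq (⟨A'.of, k, ObLE.refl _⟩ : LHom A A') g (LHom.hom g) (le_refl (Ar.mk _))

/-- `κ` on objects: `[A ⟶ B' ≤ B] ↦ B'`. -/
def kappaObj (P : GCat (LCat X)) : X :=
  Subobject.lift (fun _ f _ => LHom.mid f)
    (by
      intro A A' f g _ _ i h
      obtain ⟨k, hk, -⟩ := LHom.iso_comp i g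
      rw [← h, hk]) P.sub

/-- `κ` on horizontal arrows: the class of the span
`(A ⟶ B' ≤ B, A ⟶ C' ≤ C)` with horizontal parts `h` and `k` goes to `k h⁻¹ : B' ⟶ C'`. -/
def kappaSpan {B C : LCat X} (q : SpanClass B C) : Ar X :=
  Quotient.lift
    (fun p : SpanRep B C => Ar.mk (Groupoid.inv (LHom.hom p.left) ≫ LHom.hom p.right))
    (by
      rintro ⟨l, r⟩ ⟨l', r'⟩ ⟨i, h₁, h₂⟩
      dsimp only at i h₁ h₂
      obtain ⟨k, hk, hi⟩ := LHom.iso_comp i l'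
      obtain ⟨k', hk', hi'⟩ := LHom.iso_comp i r'
      have hkk : k = k' := by
        have := hi.symm.trans hi'
        exact eq_of_heq (LHom.mk.inj this).2
      subst hkk
      dsimp only
      rw [← h₁, ← h₂, hk, hk']
      simp) q

theorem kappaSpan_mk {A B C : LCat X} (m : A ⟶ B) (n : A ⟶ C) :
    kappaSpan (SpanClass.mk m n) = Ar.mk (Groupoid.inv (LHom.hom m) ≫ LHom.hom n) := rfl

theorem kappaObj_mk {A B : LCat X} (m : A ⟶ B) {S : Subobject B} (h : Subobject.mk m = S) :
    kappaObj ⟨B, S⟩ = LHom.mid m := by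
  subst h
  rfl

theorem kappaSpan_dom {P Q : GCat (LCat X)} (f : P ⟶ Q) :
    (kappaSpan (GHom.span f)).dom = kappaObj P := by
  obtain ⟨A, k, m, hf, hk, hm⟩ := GHom.exists_rep₁ f
  rw [hf, kappaSpan_mk]
  exact (kappaObj_mk k hk).symm

theorem kappaSpan_cod {P Q : GCat (LCat X)} (f : P ⟶ Q) :
    (kappaSpan (GHom.span f)).cod = kappaObj Q := by
  obtain ⟨A, k, m, hf, hk, hm⟩ := GHom.exists_rep₁ f
  rw [hf, kappaSpan_mk]
  exact (kappaObj_mk m hm).symm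

/-- The arrow `κ P ⟶ κ Q` underlying `kappaSpan`. -/
def kappaMap {P Q : GCat (LCat X)} (f : P ⟶ Q) : kappaObj P ⟶ kappaObj Q :=
  eqToHom (kappaSpan_dom f).symm ≫ (kappaSpan (GHom.span f)).hom ≫ eqToHom (kappaSpan_cod f)

theorem Ar.mk_eqToHom (a : Ar X) {A B : X} (h : A = a.dom) (h' : a.cod = B) :
    Ar.mk (eqToHom h ≫ a.hom ≫ eqToHom h') = a := by
  subst h h'
  simp

theorem Ar.mk_inj {A B : X} {f g : A ⟶ B} (h : Ar.mk f = Ar.mk g) : f = g := by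
  cases h
  rfl

theorem mk_kappaMap {P Q : GCat (LCat X)} (f : P ⟶ Q) :
    Ar.mk (kappaMap f) = kappaSpan (GHom.span f) := Ar.mk_eqToHom _ _ _

theorem Ar.mk_comp_congr {A B C A' B' C' : X} {f : A ⟶ B} {g : B ⟶ C} {f' : A' ⟶ B'}
    {g' : B' ⟶ C'} (h : Ar.mk f = Ar.mk f') (h' : Ar.mk g = Ar.mk g') :
    Ar.mk (f ≫ g) = Ar.mk (f' ≫ g') := by
  cases h
  cases h'
  rfl

theorem kappaSpan_mono {B C : LCat X} {p q : SpanClass B C} (h : p ≤ q) :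
    kappaSpan p ≤ kappaSpan q := by
  induction p using SpanClass.ind with
  | h k m =>
  induction q using SpanClass.ind with
  | h k' m' =>
  obtain ⟨x, h₁, h₂⟩ := SpanClass.mk_le_mk.1 h
  rw [kappaSpan_mk, kappaSpan_mk, ← h₁, ← h₂]
  have : Groupoid.inv (LHom.hom (x ≫ k')) ≫ LHom.hom (x ≫ m') =
      Groupoid.inv (res (LHom.hom k') (LHom.le x)) ≫ res (LHom.hom m') (LHom.le x) := by
    simp [LHom.comp_def, LHom.comp]
  rw [this]
  exact OrderedGroupoid.comp_le (OrderedGroupoid.inv_le (res_le _ _)) (res_le _ _)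

variable (X) in
/-- The ordered functor `κ : GL(X) ⟶ X`. -/
def kappa : OrderedFunctor (GCat (LCat X)) X where
  obj := kappaObj
  map := kappaMap
  map_id P := by
    apply Ar.mk_inj
    rw [mk_kappaMap]
    change kappaSpan (GHom.id P).span = _
    have hP : Subobject.mk P.sub.arrow = P.sub := Subobject.mk_arrow _
    rw [GHom.id_span P hP, kappaSpan_mk, Groupoid.inv_comp]
    change _ = Ar.mk (𝟙 (kappaObj ⟨P.base, P.sub⟩))
    rw [kappaObj_mk _ hP]
  map_comp {P Q R} f g := by
    apply Ar.mk_inj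
    rw [mk_kappaMap]
    change kappaSpan (GHom.comp f g).span = _
    obtain ⟨A, k, m, n, hf, hg⟩ := GHom.exists_rep₂ f g
    have hf' := mk_kappaMap f
    have hg' := mk_kappaMap g
    rw [hf, kappaSpan_mk] at hf'
    rw [hg, kappaSpan_mk] at hg'
    rw [Ar.mk_comp_congr hf' hg', GHom.comp_span f g hf hg, kappaSpan_mk]
    simp
  monotone := by
    rintro ⟨B, S⟩ ⟨B', S'⟩ ⟨D, T⟩ ⟨D', T'⟩ f f' h
    obtain ⟨h₁, h₂⟩ := arToSpan_le h
    dsimp only at h₁ h₂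
    subst h₁ h₂
    rw [mk_kappaMap, mk_kappaMap]
    exact kappaSpan_mono (arToSpan_le_iff.1 h)

end

/-! ### Ordered groupoids as double categories -/

section

/-- Vertical category of objects: the poset of objects of `X`. -/
@[ext] structure VOb (X : Type u) : Type u where
  of : X

/-- Composable pairs of horizontal arrows. -/
structure ArPair (X : Type u) [Category.{u} X] : Type u where
  {dom : X}
  {mid : X}
  {cod : X}
  fst : dom ⟶ mid
  snd : mid ⟶ cod

variable {X Y : Type u} [OrderedGroupoid X] [OrderedGroupoid Y]

instance : PartialOrder (VOb X) where
  le A B := ObLE A.of B.of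
  le_refl A := ObLE.refl A.of
  le_trans _ _ _ := ObLE.trans
  le_antisymm _ _ h k := VOb.ext (ObLE.antisymm h k)

/-- The two arrows of a composable pair. -/
def ArPair.toProd (p : ArPair X) : Ar X × Ar X := (Ar.mk p.fst, Ar.mk p.snd)

theorem ArPair.toProd_injective : Function.Injective (ArPair.toProd (X := X)) := by
  rintro ⟨f, g⟩ ⟨f', g'⟩ h
  obtain ⟨h₁, h₂⟩ := Prod.mk.inj h
  cases h₁
  cases h₂
  rfl

instance : PartialOrder (ArPair X) := PartialOrder.lift ArPair.toProd ArPair.toProd_injective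

/-- A composable pair from two arrows. -/
def ArPair.of (a b : Ar X) (h : a.cod = b.dom) : ArPair X := ⟨a.hom, eqToHom h ≫ b.hom⟩

theorem ArPair.toProd_of (a b : Ar X) (h : a.cod = b.dom) : (ArPair.of a b h).toProd = (a, b) := by
  rcases a with ⟨a⟩
  rcases b with ⟨b⟩
  dsimp only at h
  subst h
  simp [ArPair.of, ArPair.toProd]

/-- The composite of a composable pair. -/
def ArPair.comp (p : ArPair X) : Ar X := Ar.mk (p.fst ≫ p.snd)

theorem Ar.dom_mono {a b : Ar X} (h : a ≤ b) : (⟨a.dom⟩ : VOb X) ≤ ⟨b.dom⟩ := obLE_dom h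

theorem Ar.cod_mono {a b : Ar X} (h : a ≤ b) : (⟨a.cod⟩ : VOb X) ≤ ⟨b.cod⟩ := obLE_cod h

theorem posetHom_eq {P : Type u} [PartialOrder P] {a b : P} (f g : a ⟶ b) : f = g :=
  Subsingleton.elim _ _

theorem cat_hom_ext {T : Cat.{u, u}} {P : Type u} [PartialOrder P] {F G : T ⟶ Cat.of P}
    (h : ∀ x, F.toFunctor.obj x = G.toFunctor.obj x) : F = G :=
  Cat.Hom.ext (CategoryTheory.Functor.ext h (fun _ _ _ => posetHom_eq (P := P) _ _))

/-- The functor between posetal categories given by a monotone map. -/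
abbrev monoHom {P Q : Type u} [PartialOrder P] [PartialOrder Q] (f : P → Q) (hf : Monotone f) :
    Cat.of P ⟶ Cat.of Q := hf.functor.toCatHom

variable (X) in
/-- The domain functor. -/
abbrev sHom : Cat.of (Ar X) ⟶ Cat.of (VOb X) :=
  monoHom (fun a => ⟨a.dom⟩) (fun _ _ h => Ar.dom_mono h)

variable (X) in
/-- The codomain functor. -/
abbrev tHom : Cat.of (Ar X) ⟶ Cat.of (VOb X) :=
  monoHom (fun a => ⟨a.cod⟩) (fun _ _ h => Ar.cod_mono h)

variable (X) in
/-- The identity-arrow functor. -/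
abbrev eHom : Cat.of (VOb X) ⟶ Cat.of (Ar X) := monoHom (fun A => Ar.mk (𝟙 A.of)) (fun _ _ h => h)

variable (X) in
/-- First projection of composable pairs. -/
abbrev p₁Hom : Cat.of (ArPair X) ⟶ Cat.of (Ar X) :=
  monoHom (fun p => Ar.mk p.fst) (fun _ _ h => h.1)

variable (X) in
/-- Second projection of composable pairs. -/
abbrev p₂Hom : Cat.of (ArPair X) ⟶ Cat.of (Ar X) :=
  monoHom (fun p => Ar.mk p.snd) (fun _ _ h => h.2)

variable (X) in
/-- The composition functor. -/
abbrev mHom : Cat.of (ArPair X) ⟶ Cat.of (Ar X) :=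
  monoHom ArPair.comp (fun _ _ h => OrderedGroupoid.comp_le h.1 h.2)

/-- The value of a functor to `Ar X`. -/
def objAr {T : Cat.{u, u}} (f : T ⟶ Cat.of (Ar X)) (x : T) : Ar X := f.toFunctor.obj x

theorem objAr_mono {T : Cat.{u, u}} (f : T ⟶ Cat.of (Ar X)) {x y : T} (a : x ⟶ y) :
    objAr f x ≤ objAr f y := leOfHom (f.toFunctor.map a)

theorem composable_obj {T : Cat.{u, u}} {f g : T ⟶ Cat.of (Ar X)} (h : f ≫ tHom X = g ≫ sHom X)
    (x : T) : (objAr f x).cod = (objAr g x).dom :=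
  congrArg VOb.of (CategoryTheory.Functor.congr_obj (congrArg Cat.Hom.toFunctor h) x)

/-- The functor to composable pairs induced by two functors to arrows. -/
def pairLift {T : Cat.{u, u}} (f g : T ⟶ Cat.of (Ar X)) (h : f ≫ tHom X = g ≫ sHom X) :
    T ⟶ Cat.of (ArPair X) :=
  Functor.toCatHom
    { obj := fun x => ArPair.of (objAr f x) (objAr g x) (composable_obj h x)
      map := fun {x y} a => homOfLE (by
        change ArPair.toProd _ ≤ ArPair.toProd _
        rw [ArPair.toProd_of, ArPair.toProd_of]
        exact ⟨objAr_mono f a, objAr_mono g a⟩)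
      map_id := fun _ => Subsingleton.elim _ _
      map_comp := fun _ _ => Subsingleton.elim _ _ }

theorem pairLift_fst {T : Cat.{u, u}} (f g : T ⟶ Cat.of (Ar X)) (h : f ≫ tHom X = g ≫ sHom X) :
    pairLift f g h ≫ p₁Hom X = f :=
  cat_hom_ext fun x => congrArg Prod.fst (ArPair.toProd_of (objAr f x) (objAr g x) _)

theorem pairLift_snd {T : Cat.{u, u}} (f g : T ⟶ Cat.of (Ar X)) (h : f ≫ tHom X = g ≫ sHom X) :
    pairLift f g h ≫ p₂Hom X = g :=
  cat_hom_ext fun x => congrArg Prod.snd (ArPair.toProd_of (objAr f x) (objAr g x) _)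

theorem arPair_hom_ext {T : Cat.{u, u}} {a b : T ⟶ Cat.of (ArPair X)}
    (h₁ : a ≫ p₁Hom X = b ≫ p₁Hom X) (h₂ : a ≫ p₂Hom X = b ≫ p₂Hom X) : a = b :=
  cat_hom_ext fun x => ArPair.toProd_injective <| Prod.ext
    (CategoryTheory.Functor.congr_obj (congrArg Cat.Hom.toFunctor h₁) x)
    (CategoryTheory.Functor.congr_obj (congrArg Cat.Hom.toFunctor h₂) x)

variable (X) in
theorem isPullback_arPair : IsPullback (p₁Hom X) (p₂Hom X) (tHom X) (sHom X) where
  w := rfl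
  isLimit' := ⟨PullbackCone.IsLimit.mk _ (fun s => pairLift s.fst s.snd s.condition)
    (fun _ => pairLift_fst _ _ _) (fun _ => pairLift_snd _ _ _)
    (fun _ _ h₁ h₂ => arPair_hom_ext (h₁.trans (pairLift_fst _ _ _).symm)
      (h₂.trans (pairLift_snd _ _ _).symm))⟩

theorem lift_eq {T : Cat.{u, u}} (f g : T ⟶ Cat.of (Ar X)) (h : f ≫ tHom X = g ≫ sHom X) :
    (isPullback_arPair X).lift f g h = pairLift f g h := by
  apply arPair_hom_ext
  · rw [IsPullback.lift_fst, pairLift_fst]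
  · rw [IsPullback.lift_snd, pairLift_snd]

/-- The composite of two composable arrows. -/
def Ar.comp (a b : Ar X) (h : a.cod = b.dom) : Ar X := Ar.mk (a.hom ≫ eqToHom h ≫ b.hom)

theorem lift_mHom_obj {T : Cat.{u, u}} (f g : T ⟶ Cat.of (Ar X)) (h : f ≫ tHom X = g ≫ sHom X)
    (x : T) : objAr ((isPullback_arPair X).lift f g h ≫ mHom X) x =
      Ar.comp (objAr f x) (objAr g x) (composable_obj h x) := by
  rw [lift_eq]
  rfl

theorem Ar.id_comp (a b : Ar X) (h : b.cod = a.dom) (hb : b = Ar.mk (𝟙 a.dom)) :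
    Ar.comp b a h = a := by
  subst hb
  simp [Ar.comp]

theorem Ar.comp_id (a b : Ar X) (h : a.cod = b.dom) (hb : b = Ar.mk (𝟙 a.cod)) :
    Ar.comp a b h = a := by
  subst hb
  simp [Ar.comp]

theorem Ar.comp_assoc (a b c d e : Ar X) (hab : a.cod = b.dom) (hbc : b.cod = c.dom)
    (hd : d = Ar.comp a b hab) (he : e = Ar.comp b c hbc) (h₁ : d.cod = c.dom)
    (h₂ : a.cod = e.dom) : Ar.comp d c h₁ = Ar.comp a e h₂ := by
  subst hd he
  simp [Ar.comp]

variable (X) in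
/-- An ordered groupoid as a double category, that is, an internal category in `Cat`: its category
of objects is the poset of objects (vertical arrows), and its category of arrows is the poset of
horizontal arrows (double cells). -/
def doubleCategory : InternalCategory Cat.{u, u} where
  C₀ := Cat.of (VOb X)
  C₁ := Cat.of (Ar X)
  C₂ := Cat.of (ArPair X)
  s := sHom X
  t := tHom X
  e := eHom X
  p₁ := p₁Hom X
  p₂ := p₂Hom X
  isPullback := isPullback_arPair X
  m := mHom X
  e_s := rfl
  e_t := rfl
  m_s := rfl
  m_t := rfl
  e_m f h := cat_hom_ext fun x =>
    (lift_mHom_obj _ _ h x).trans (Ar.id_comp (objAr f x) _ _ rfl)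
  m_e f h := cat_hom_ext fun x =>
    (lift_mHom_obj _ _ h x).trans (Ar.comp_id (objAr f x) _ _ rfl)
  assoc f g k hfg hgk h₁ h₂ := cat_hom_ext fun x =>
    (lift_mHom_obj _ _ h₁ x).trans ((Ar.comp_assoc (objAr f x) (objAr g x) (objAr k x) _ _ _ _
      (lift_mHom_obj _ _ hfg x) (lift_mHom_obj _ _ hgk x) _ _).trans
        (lift_mHom_obj _ _ h₂ x).symm)

theorem OrderedFunctor.comp_map (F : OrderedFunctor X Y) (p : ArPair X) (a b : Ar Y)
    (ha : a = Ar.mk (F.map p.fst)) (hb : b = Ar.mk (F.map p.snd)) (h : a.cod = b.dom) :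
    Ar.mk (F.map (p.fst ≫ p.snd)) = Ar.comp a b h := by
  subst ha hb
  simp [Ar.comp]

/-- An ordered functor as a double functor. -/
def OrderedFunctor.toDoubleFunctor (F : OrderedFunctor X Y) :
    InternalFunctor (doubleCategory X) (doubleCategory Y) where
  F₀ := monoHom (P := VOb X) (Q := VOb Y) (fun A => ⟨F.obj A.of⟩) (fun A B h => by
    have := F.monotone h
    rw [F.map_id, F.map_id] at this
    exact this)
  F₁ := monoHom (P := Ar X) (Q := Ar Y) (fun a => Ar.mk (F.map a.hom)) (fun _ _ h => F.monotone h)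
  map_s := rfl
  map_t := rfl
  map_e := cat_hom_ext fun A => congrArg Ar.mk (F.map_id A.of)
  map_m h := cat_hom_ext fun p => by
    refine Eq.trans ?_ (lift_mHom_obj _ _ h p).symm
    exact F.comp_map p _ _ rfl rfl _

end

end

/-! In `L(X)` every arrow is an isomorphism (its horizontal part) followed by an inclusion. Hence
each subobject of `B` is the class of the inclusion of exactly one `D ≤ B`, and `κ` returns this
`D`. So an object of `GL(X)` amounts to a pair `D ≤ B`, an arrow from `D ≤ B` to `E ≤ C` amounts to
an arrow `D ⟶ E` of `X`, and one arrow lies below another exactly when the bases agree and the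
images under `κ` are so ordered. This is full faithfulness: `GHom.le_of_kappaMap_le` and
`exists_kappaMap_eq` are what the criterion `isPullback_prod_poset` asks for.

For essential surjectivity, the map to be studied sends a pair `(P, a)`, with `a` an arrow out of `κ
P`, to the codomain of `a`. Given `B' ≤ cod a`, restricting `a⁻¹` to `B'` and inverting yields the
unique arrow below `a` with codomain `B'`. Its domain lies below `κ P`, and together with the base
of `P` it determines an object below `P`. The map is therefore a discrete fibration
(`isDiscreteFibration_kappaTarget`), and identity arrows show that it is surjective on objects.

Such a map `p : E ⟶ P` is of effective descent by the monadicity theorem for reflexive coequalizers.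
Discrete fibrations lift factorizations, so they are exponentiable: `Z ↦ Z ×_P E`, as a functor from
`Cat/P` to `Cat`, has a right adjoint built from families on the fibres (`FibreFamily`), and thus
preserves colimits. It reflects isomorphisms because objects and relations of `P` lift to `E`, so
that full faithfulness and bijectivity on objects can be tested after pulling back. -/

noncomputable section

/-! ### Pullbacks of categories over a poset -/

section

variable {P Z E : Type u} [PartialOrder P] [Category.{u} Z] [Category.{u} E]

/-- The pullback of two functors with values in a poset. -/
@[ext] structure PosetPullback (h : Z ⥤ P) (p : E ⥤ P) : Type u where
  fst : Z
  snd : E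
  w : h.obj fst = p.obj snd

namespace PosetPullback

/-- No compatibility is required of the two arrows: their images in the poset `P` are parallel,
hence equal. -/
instance (h : Z ⥤ P) (p : E ⥤ P) : Category.{u} (PosetPullback h p) where
  Hom x y := (x.fst ⟶ y.fst) × (x.snd ⟶ y.snd)
  id x := (𝟙 x.fst, 𝟙 x.snd)
  comp f g := (f.1 ≫ g.1, f.2 ≫ g.2)

variable (h : Z ⥤ P) (p : E ⥤ P)

/-- The first projection. -/
def fstFunctor : PosetPullback h p ⥤ Z where
  obj x := x.fst
  map f := f.1

/-- The second projection. -/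
def sndFunctor : PosetPullback h p ⥤ E where
  obj x := x.snd
  map f := f.2

theorem functor_ext {T : Type u} [Category.{u} T] {F G : T ⥤ PosetPullback h p}
    (h₁ : F ⋙ fstFunctor h p = G ⋙ fstFunctor h p)
    (h₂ : F ⋙ sndFunctor h p = G ⋙ sndFunctor h p) : F = G := by
  have hobj : ∀ x, F.obj x = G.obj x := fun x =>
    PosetPullback.ext (Functor.congr_obj h₁ x) (Functor.congr_obj h₂ x)
  -- The endpoints agree only propositionally, so arrows are compared heterogeneously, one component
  -- at a time.
  have aux : ∀ {a b a' b' : PosetPullback h p} (f : a ⟶ b) (g : a' ⟶ b'), a = a' → b = b' →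
      HEq f.1 g.1 → HEq f.2 g.2 → HEq f g := by
    rintro a b _ _ f g rfl rfl e₁ e₂
    exact heq_of_eq (Prod.ext (eq_of_heq e₁) (eq_of_heq e₂))
  refine Functor.hext hobj fun x y f => ?_
  refine aux _ _ (hobj x) (hobj y) ?_ ?_
  · have := Functor.hcongr_hom h₁ f
    exact this
  · have := Functor.hcongr_hom h₂ f
    exact this

variable {h p} in
/-- The functor to the pullback induced by two functors. -/
def lift {T : Type u} [Category.{u} T] (a : T ⥤ Z) (b : T ⥤ E) (w : a ⋙ h = b ⋙ p) :
    T ⥤ PosetPullback h p where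
  obj x := ⟨a.obj x, b.obj x, Functor.congr_obj w x⟩
  map f := (a.map f, b.map f)
  map_id x := Prod.ext (a.map_id x) (b.map_id x)
  map_comp f g := Prod.ext (a.map_comp f g) (b.map_comp f g)

end PosetPullback

end

/-- A morphism of `Cat` to a poset, as a functor. -/
def toPoset {P : Type u} [PartialOrder P] {Z : Cat.{u, u}} (h : Z ⟶ Cat.of P) : Z ⥤ P :=
  h.toFunctor

theorem isPullback_posetPullback {P : Type u} [PartialOrder P] {Z E : Cat.{u, u}}
    (h : Z ⟶ Cat.of P) (p : E ⟶ Cat.of P) :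
    IsPullback (PosetPullback.fstFunctor (toPoset h) (toPoset p)).toCatHom
      (PosetPullback.sndFunctor (toPoset h) (toPoset p)).toCatHom h p where
  w := cat_hom_ext (P := P) fun x => PosetPullback.w x
  isLimit' := ⟨PullbackCone.IsLimit.mk _
    (fun s => (PosetPullback.lift (h := toPoset h) (p := toPoset p) s.fst.toFunctor s.snd.toFunctor
      (congrArg Cat.Hom.toFunctor s.condition)).toCatHom)
    (fun _ => rfl) (fun _ => rfl)
    (fun _ _ h₁ h₂ => Cat.Hom.ext (PosetPullback.functor_ext _ _
      (congrArg Cat.Hom.toFunctor h₁) (congrArg Cat.Hom.toFunctor h₂)))⟩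

/-! ### Pulling back along a discrete fibration -/

/-- A functor `p` from a thin category to a poset is a discrete fibration if every relation
`b ≤ p e` has a unique lift with codomain `e`. -/
structure IsDiscreteFibration {P E : Type u} [PartialOrder P] [Category.{u} E] (p : E ⥤ P) :
    Prop where
  thin : ∀ {a b : E} (f g : a ⟶ b), f = g
  exists_lift : ∀ (e : E) (b : P), b ≤ p.obj e → ∃ e', p.obj e' = b ∧ Nonempty (e' ⟶ e)
  lift_unique : ∀ {e a b : E}, (a ⟶ e) → (b ⟶ e) → p.obj a = p.obj b → a = b

namespace IsDiscreteFibration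

variable {P E : Type u} [PartialOrder P] [Category.{u} E] {p : E ⥤ P}

/-- This is the Conduché condition, which makes composition in the exponential possible. Lift `b' ≤
b''` to an arrow into `e''`, then `b ≤ b'` to an arrow into its domain. The composite and `l` both
lift `b ≤ b''`, so they start at the same object. -/
theorem exists_factor (hp : IsDiscreteFibration p) {b b' b'' : P} (h : b ≤ b') (h' : b' ≤ b'')
    {e e'' : E} (he : p.obj e = b) (he'' : p.obj e'' = b'') (l : e ⟶ e'') :
    ∃ e', p.obj e' = b' ∧ Nonempty (e ⟶ e') ∧ Nonempty (e' ⟶ e'') := by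
  obtain ⟨e', he', ⟨l'⟩⟩ := hp.exists_lift e'' b' (by rwa [he''])
  obtain ⟨a, ha, ⟨k⟩⟩ := hp.exists_lift e' b (by rwa [he'])
  obtain rfl := hp.lift_unique l (k ≫ l') (he.trans ha.symm)
  exact ⟨e', he', ⟨k⟩, ⟨l'⟩⟩

end IsDiscreteFibration

/-- The objects of the exponential of `W` along `p`: the pairs of an element `b` and a family of
objects of `W` indexed by the fibre of `p` over `b`. -/
structure FibreFamily {P E : Type u} [PartialOrder P] [Category.{u} E] {p : E ⥤ P}
    (hp : IsDiscreteFibration p) (W : Type u) : Type u where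
  base : P
  val : ∀ e : E, p.obj e = base → W

namespace FibreFamily

variable {P E : Type u} [PartialOrder P] [Category.{u} E] {p : E ⥤ P}
  {hp : IsDiscreteFibration p} {W : Type u} [Category.{u} W]

/-- A morphism of families over a relation `b ≤ b'`. -/
@[ext] structure Hom (x y : FibreFamily hp W) : Type u where
  le : x.base ≤ y.base
  app : ∀ {e e' : E} (he : p.obj e = x.base) (he' : p.obj e' = y.base) (_ : e ⟶ e'),
    x.val e he ⟶ y.val e' he'

namespace Hom

variable {x y z : FibreFamily hp W}

/-- The identity of a family. -/
def id (x : FibreFamily hp W) : Hom x x where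
  le := le_rfl
  -- An arrow inside one fibre joins equal objects, since it and the identity lift the same
  -- relation.
  app {e e'} he he' l := eqToHom (by
    obtain rfl := hp.lift_unique l (𝟙 e') (he.trans he'.symm)
    rfl)

/-- The composite of two morphisms of families. -/
def comp (f : Hom x y) (g : Hom y z) : Hom x z where
  le := f.le.trans g.le
  app he he'' l :=
    have H := hp.exists_factor f.le g.le he he'' l
    f.app he H.choose_spec.1 H.choose_spec.2.1.some ≫ g.app _ he'' H.choose_spec.2.2.some

theorem id_app {e : E} (he : p.obj e = x.base) (l : e ⟶ e) : (id x).app he he l = 𝟙 _ := rfl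

/-- The composite is defined through a chosen middle object. That object is unique because lifts
into `e''` are, and the arrows are unique by thinness, so any factorization computes it. -/
theorem comp_app (f : Hom x y) (g : Hom y z) {e e' e'' : E} (he : p.obj e = x.base)
    (he' : p.obj e' = y.base) (he'' : p.obj e'' = z.base) (l : e ⟶ e') (l' : e' ⟶ e'')
    (k : e ⟶ e'') : (f.comp g).app he he'' k = f.app he he' l ≫ g.app he' he'' l' := by
  have H := hp.exists_factor f.le g.le he he'' k
  change f.app he H.choose_spec.1 H.choose_spec.2.1.some ≫ g.app _ he'' H.choose_spec.2.2.some = _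
  have key : ∀ (a : E) (ha : p.obj a = y.base) (m : e ⟶ a) (m' : a ⟶ e''),
      f.app he ha m ≫ g.app ha he'' m' = f.app he he' l ≫ g.app he' he'' l' := by
    intro a ha m m'
    obtain rfl := hp.lift_unique m' l' (ha.trans he'.symm)
    rw [hp.thin m l, hp.thin m' l']
  exact key _ _ _ _

end Hom

instance : Category.{u} (FibreFamily hp W) where
  Hom := Hom
  id := Hom.id
  comp := Hom.comp
  id_comp {x y} f := by
    refine Hom.ext ?_
    funext e e' he he' l
    rw [Hom.comp_app (Hom.id x) f he he he' (𝟙 e) l l, Hom.id_app, Category.id_comp]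
  comp_id {x y} f := by
    refine Hom.ext ?_
    funext e e' he he' l
    rw [Hom.comp_app f (Hom.id y) he he' he' l (𝟙 e') l, Hom.id_app, Category.comp_id]
  assoc {x y z w} f g k := by
    refine Hom.ext ?_
    funext e e₃ he he₃ l
    obtain ⟨e₂, he₂, ⟨l₁⟩, ⟨l₂⟩⟩ := hp.exists_factor (f.le.trans g.le) k.le he he₃ l
    obtain ⟨e₁, he₁, ⟨m₁⟩, ⟨m₂⟩⟩ := hp.exists_factor f.le g.le he he₂ l₁
    rw [Hom.comp_app (f.comp g) k he he₂ he₃ l₁ l₂, Hom.comp_app f g he he₁ he₂ m₁ m₂,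
      Hom.comp_app f (g.comp k) he he₁ he₃ m₁ (m₂ ≫ l₂), Hom.comp_app g k he₁ he₂ he₃ m₂ l₂,
      Category.assoc]

variable (hp W) in
/-- The projection of the exponential. -/
def proj : FibreFamily hp W ⥤ P where
  obj x := x.base
  map f := homOfLE (Hom.le f)

/-- The functor to the exponential corresponding to a functor from a pullback. -/
def curry {Z : Type u} [Category.{u} Z] {h : Z ⥤ P} (G : PosetPullback h p ⥤ W) :
    Z ⥤ FibreFamily hp W where
  obj z := ⟨h.obj z, fun e he => G.obj ⟨z, e, he.symm⟩⟩
  map {z z'} a :=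
    { le := leOfHom (h.map a)
      app := fun {e e'} he he' l =>
        G.map (X := ⟨z, e, he.symm⟩) (Y := ⟨z', e', he'.symm⟩) (a, l) }
  map_id z := by
    refine Hom.ext ?_
    funext e e' he he' l
    obtain rfl := hp.lift_unique l (𝟙 e') (he.trans he'.symm)
    obtain rfl := hp.thin l (𝟙 _)
    exact G.map_id ⟨z, e, he.symm⟩
  map_comp {x y z} a b := by
    refine Hom.ext ?_
    funext e e' he he' l
    obtain ⟨e₁, he₁, ⟨l₁⟩, ⟨l₂⟩⟩ := hp.exists_factor (leOfHom (h.map a)) (leOfHom (h.map b)) he he' l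
    obtain rfl := hp.thin (l₁ ≫ l₂) l
    refine Eq.trans ?_ (Hom.comp_app _ _ he he₁ he' l₁ l₂ _).symm
    exact G.map_comp (X := ⟨x, e, he.symm⟩) (Y := ⟨y, e₁, he₁.symm⟩) (Z := ⟨z, e', he'.symm⟩)
      (a, l₁) (b, l₂)

/-- The functor from a pullback corresponding to a functor to the exponential. -/
def uncurry {Z : Type u} [Category.{u} Z] {h : Z ⥤ P} (K : Z ⥤ FibreFamily hp W)
    (hK : K ⋙ proj hp W = h) : PosetPullback h p ⥤ W where
  obj x := (K.obj x.fst).val x.snd (x.w.symm.trans (Functor.congr_obj hK x.fst).symm)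
  map f := Hom.app (K.map f.1) _ _ f.2
  map_id x := (congrArg (fun k : Hom _ _ => k.app _ _ _) (K.map_id x.fst)).trans (Hom.id_app _ _)
  map_comp f g := (congrArg (fun k : Hom _ _ => k.app _ _ _) (K.map_comp f.1 g.1)).trans
    (Hom.comp_app _ _ _ _ _ _ _ _)

theorem curry_uncurry {Z : Type u} [Category.{u} Z] {h : Z ⥤ P} (K : Z ⥤ FibreFamily hp W)
    (hK : K ⋙ proj hp W = h) : curry (uncurry K hK) = K := by
  -- With `h` replaced by the composite through the exponential, the round trip holds by definition.
  subst hK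
  rfl

end FibreFamily

/-- The pullback functor along `p`, with the canonical pullbacks over a poset. -/
def posetPullbackFunctor {P : Type u} [PartialOrder P] {E : Cat.{u, u}} (p : E ⟶ Cat.of P) :
    Over (Cat.of P) ⥤ Cat.{u, u} where
  obj Z := Cat.of (PosetPullback (toPoset Z.hom) (toPoset p))
  map {Z Z'} f := (PosetPullback.lift (h := toPoset Z'.hom) (p := toPoset p)
    (PosetPullback.fstFunctor (toPoset Z.hom) (toPoset p) ⋙ f.left.toFunctor)
    (PosetPullback.sndFunctor (toPoset Z.hom) (toPoset p)) (by
      have h : f.left.toFunctor ⋙ toPoset Z'.hom = toPoset Z.hom :=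
        congrArg Cat.Hom.toFunctor (Over.w f)
      rw [Functor.assoc, h]
      exact congrArg Cat.Hom.toFunctor (isPullback_posetPullback Z.hom p).w)).toCatHom
  map_id _ := rfl
  map_comp _ _ := rfl

/-- The pullback functor along `p` is isomorphic to the canonical one. -/
def posetPullbackFunctorIso {P : Type u} [PartialOrder P] {E : Cat.{u, u}} (p : E ⟶ Cat.of P) :
    posetPullbackFunctor p ≅ Over.pullback p ⋙ Over.forget E :=
  NatIso.ofComponents (fun Z => (isPullback_posetPullback Z.hom p).isoPullback) (by
    intro Z Z' f
    have h := isPullback_posetPullback Z.hom p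
    have h' := isPullback_posetPullback Z'.hom p
    apply pullback.hom_ext
    · refine (congrArg ((posetPullbackFunctor p).map f ≫ ·) h'.isoPullback_hom_fst).trans ?_
      refine Eq.trans ?_ (congrArg (h.isoPullback.hom ≫ ·) (pullback.lift_fst _ _ _).symm)
      exact (congrArg (· ≫ f.left) h.isoPullback_hom_fst).symm
    · refine (congrArg ((posetPullbackFunctor p).map f ≫ ·) h'.isoPullback_hom_snd).trans ?_
      refine Eq.trans ?_ (congrArg (h.isoPullback.hom ≫ ·) (pullback.lift_snd _ _ _).symm)
      exact h.isoPullback_hom_snd.symm)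

/-- Functors from the pullback of `Z` along `p` correspond to functors over the base from `Z` to the
exponential. -/
def posetPullbackHomEquiv {P : Type u} [PartialOrder P] {E : Cat.{u, u}}
    {p : E ⟶ Cat.of P} (hp : IsDiscreteFibration (toPoset p)) (Z : Over (Cat.of P))
    (W : Cat.{u, u}) : ((posetPullbackFunctor p).obj Z ⟶ W) ≃
      (Z ⟶ Over.mk (Y := Cat.of (FibreFamily hp W)) (FibreFamily.proj hp W).toCatHom) where
  toFun G := Over.homMk
    (FibreFamily.curry (hp := hp) (h := toPoset Z.hom) (W := W) G.toFunctor).toCatHom rfl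
  invFun K := (FibreFamily.uncurry (hp := hp) (h := toPoset Z.hom) (W := W) K.left.toFunctor
    (congrArg Cat.Hom.toFunctor (Over.w K))).toCatHom
  left_inv _ := rfl
  right_inv K := Over.OverMorphism.ext (Cat.Hom.ext (FibreFamily.curry_uncurry (h := toPoset Z.hom) (W := W) _
    (congrArg Cat.Hom.toFunctor (Over.w K))))

theorem isLeftAdjoint_posetPullbackFunctor {P : Type u} [PartialOrder P] {E : Cat.{u, u}}
    {p : E ⟶ Cat.of P} (hp : IsDiscreteFibration (toPoset p)) :
    (posetPullbackFunctor p).IsLeftAdjoint where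
  exists_rightAdjoint := ⟨_, ⟨Adjunction.adjunctionOfEquivRight (posetPullbackHomEquiv hp)
    -- Naturality in `Z` suffices, and it holds by definition once both sides are uncurried.
    (fun Z' Z W f g => by
      obtain ⟨K, rfl⟩ := (posetPullbackHomEquiv hp Z W).symm.surjective g
      rw [Equiv.apply_symm_apply, ← Equiv.eq_symm_apply]
      exact Cat.Hom.ext rfl)⟩⟩

/-! ### Reflection of isomorphisms, and effective descent -/

theorem isIso_toCatHom {Z Z' : Cat.{u, u}} (f : Z ⟶ Z') [f.toFunctor.Full]
    [f.toFunctor.Faithful] (hf : Function.Bijective f.toFunctor.obj) : IsIso f := by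
  let e := Equiv.ofBijective _ hf
  have he : ∀ y, f.toFunctor.obj (e.symm y) = y := e.apply_symm_apply
  have he' : ∀ x, e.symm (f.toFunctor.obj x) = x := e.symm_apply_apply
  let J : Z' ⥤ Z :=
    { obj := fun y => e.symm y
      map := fun {x y} a => f.toFunctor.preimage (eqToHom (he x) ≫ a ≫ eqToHom (he y).symm)
      map_id := fun x => f.toFunctor.map_injective (by simp)
      map_comp := fun a b => f.toFunctor.map_injective (by simp) }
  refine ⟨J.toCatHom, Cat.Hom.ext (CategoryTheory.Functor.ext he' fun x y a => ?_),
    Cat.Hom.ext (CategoryTheory.Functor.ext he fun x y a => ?_)⟩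
  · apply f.toFunctor.map_injective
    refine (f.toFunctor.map_preimage _).trans ?_
    simp [eqToHom_map]
  · exact f.toFunctor.map_preimage _

theorem posetPullbackFunctor_reflectsIsomorphisms {P : Type u} [PartialOrder P] {E : Cat.{u, u}}
    {p : E ⟶ Cat.of P} (hp : IsDiscreteFibration (toPoset p))
    (hs : Function.Surjective (toPoset p).obj) :
    (posetPullbackFunctor p).ReflectsIsomorphisms where
  reflects {Z Z'} f hf := by
    let F := (posetPullbackFunctor p).map f
    let i := Cat.equivOfIso (asIso F)
    have hFf : F.toFunctor.FullyFaithful := i.fullyFaithfulFunctor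
    have hl : ∀ x, (inv F).toFunctor.obj (F.toFunctor.obj x) = x := fun x =>
      Functor.congr_obj (congrArg Cat.Hom.toFunctor (IsIso.hom_inv_id F)) x
    have hr : ∀ x, F.toFunctor.obj ((inv F).toFunctor.obj x) = x := fun x =>
      Functor.congr_obj (congrArg Cat.Hom.toFunctor (IsIso.inv_hom_id F)) x
    have hw : ∀ z, (toPoset Z'.hom).obj (f.left.toFunctor.obj z) = (toPoset Z.hom).obj z := fun z =>
      Functor.congr_obj (congrArg Cat.Hom.toFunctor (Over.w f)) z
    -- Surjectivity provides a point over the larger element and the fibration an arrow into it.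
    -- Hence every arrow of `Z` or `Z'` is the first component of an arrow of the pullback, where
    -- `F` is known to be invertible.
    have hlift : ∀ {z z' : Z.left}, (toPoset Z.hom).obj z ≤ (toPoset Z.hom).obj z' →
        ∃ (e e' : E) (h : (toPoset Z.hom).obj z = (toPoset p).obj e)
          (h' : (toPoset Z.hom).obj z' = (toPoset p).obj e'), Nonempty (e ⟶ e') := by
      intro z z' h
      obtain ⟨e', he'⟩ := hs ((toPoset Z.hom).obj z')
      obtain ⟨e, he, hl⟩ := hp.exists_lift e' _ (h.trans he'.ge)
      exact ⟨e, e', he.symm, he'.symm, hl⟩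
    have hfull : f.left.toFunctor.Full := ⟨fun {z z'} a => by
      obtain ⟨e, e', h, h', ⟨l⟩⟩ := hlift
        ((hw z).ge.trans ((leOfHom ((toPoset Z'.hom).map a)).trans (hw z').le))
      let x : PosetPullback (toPoset Z.hom) (toPoset p) := ⟨z, e, h⟩
      let y : PosetPullback (toPoset Z.hom) (toPoset p) := ⟨z', e', h'⟩
      obtain ⟨b, hb⟩ := hFf.map_surjective (X := x) (Y := y) (a, l)
      exact ⟨b.1, congrArg Prod.fst hb⟩⟩
    have hfaithful : f.left.toFunctor.Faithful := ⟨fun {z z'} a b hab => by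
      obtain ⟨e, e', h, h', ⟨l⟩⟩ := hlift (leOfHom ((toPoset Z.hom).map a))
      let x : PosetPullback (toPoset Z.hom) (toPoset p) := ⟨z, e, h⟩
      let y : PosetPullback (toPoset Z.hom) (toPoset p) := ⟨z', e', h'⟩
      exact congrArg Prod.fst (hFf.map_injective (X := x) (Y := y) (f := (a, l)) (g := (b, l))
        (Prod.ext hab rfl))⟩
    have hbij : Function.Bijective f.left.toFunctor.obj := by
      constructor
      · intro z z' h
        -- Objects with the same image under `f` lie over the same element, so both can be paired
        -- with one `e`; then injectivity of `F` on objects applies.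
        obtain ⟨e, he⟩ := hs ((toPoset Z.hom).obj z)
        have he' : (toPoset Z.hom).obj z' = (toPoset p).obj e := by
          rw [he, ← hw z, ← hw z', h]
        let x : PosetPullback (toPoset Z.hom) (toPoset p) := ⟨z, e, he.symm⟩
        let y : PosetPullback (toPoset Z.hom) (toPoset p) := ⟨z', e, he'⟩
        have hxy : F.toFunctor.obj x = F.toFunctor.obj y := PosetPullback.ext h rfl
        exact congrArg PosetPullback.fst ((hl x).symm.trans ((congrArg _ hxy).trans (hl y)))
      · intro z
        obtain ⟨e, he⟩ := hs ((toPoset Z'.hom).obj z)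
        let y : PosetPullback (toPoset Z'.hom) (toPoset p) := ⟨z, e, he.symm⟩
        exact ⟨_, congrArg PosetPullback.fst (hr y)⟩
    have : IsIso ((Over.forget _).map f) := isIso_toCatHom f.left hbij
    exact isIso_of_reflects_iso f (Over.forget _)

/-- A discrete fibration over a poset that is surjective on objects is of effective descent. -/
theorem IsDiscreteFibration.isEffectiveDescent {P : Type u} [PartialOrder P] {E : Cat.{u, u}}
    {p : E ⟶ Cat.of P} (hp : IsDiscreteFibration (toPoset p))
    (hs : Function.Surjective (toPoset p).obj) : IsEffectiveDescent p := by
  have := isLeftAdjoint_posetPullbackFunctor hp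
  have := posetPullbackFunctor_reflectsIsomorphisms hp hs
  have h₁ : (Over.pullback p ⋙ Over.forget E).ReflectsIsomorphisms :=
    reflectsIsomorphisms_of_iso (posetPullbackFunctorIso p)
  have : (Over.pullback p).ReflectsIsomorphisms :=
    reflectsIsomorphisms_of_comp _ (Over.forget E)
  have : PreservesColimitsOfShape WalkingParallelPair (Over.pullback p ⋙ Over.forget E) :=
    preservesColimitsOfShape_of_natIso (posetPullbackFunctorIso p)
  -- The composite to `Cat` preserves coequalizers, being isomorphic to a left adjoint, and the
  -- forgetful functor from the slice reflects them.
  have : PreservesColimitsOfShape WalkingParallelPair (Over.pullback p) :=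
    preservesColimitsOfShape_of_reflects_of_preserves _ (Over.forget E)
  have : Monad.PreservesColimitOfIsReflexivePair (Over.pullback p) := ⟨fun _ _ _ => inferInstance⟩
  exact (Monad.monadicOfHasPreservesReflexiveCoequalizersOfReflectsIsomorphisms
    (Over.mapPullbackAdj p)).eqv

/-! ### The functor `κ` is fully faithful and reflects the order -/

section

variable {X : Type u} [OrderedGroupoid X]

/-- The vertical arrow `A ≤ B`, as an arrow of `L(X)`. -/
def LHom.incl {A : X} {B : LCat X} (h : ObLE A B.of) : (⟨A⟩ : LCat X) ⟶ B :=
  (⟨A, 𝟙 A, h⟩ : LHom ⟨A⟩ B)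

/-- The isomorphism of `L(X)` given by an arrow of `X`. -/
def LHom.isoOf {A : LCat X} {B : X} (h : A.of ⟶ B) : A ≅ ⟨B⟩ where
  hom := (⟨B, h, ObLE.refl _⟩ : LHom A ⟨B⟩)
  inv := (⟨A.of, Groupoid.inv h, ObLE.refl _⟩ : LHom ⟨B⟩ A)
  hom_inv_id := (LHom.comp_eq _ _ (Groupoid.inv h) le_rfl).trans
    (by rw [Groupoid.comp_inv]; rfl)
  inv_hom_id := (LHom.comp_eq _ _ h le_rfl).trans (by rw [Groupoid.inv_comp]; rfl)

theorem LHom.isoOf_hom_comp {A C : LCat X} {B : X} (h : A.of ⟶ B) (g : (⟨B⟩ : LCat X) ⟶ C) :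
    (LHom.isoOf h).hom ≫ g = (⟨LHom.mid g, h ≫ LHom.hom g, LHom.le g⟩ : LHom A C) :=
  LHom.comp_eq _ _ _ le_rfl

theorem LHom.incl_comp {A : X} {B C : LCat X} (h : ObLE A B.of) (g : B ⟶ C) {D : X} (r : A ⟶ D)
    (hr : Ar.mk r ≤ Ar.mk (LHom.hom g)) :
    LHom.incl h ≫ g = (⟨D, r, (obLE_cod hr).trans (LHom.le g)⟩ : LHom ⟨A⟩ C) :=
  (LHom.comp_eq (LHom.incl h) g r hr).trans (LHom.ext_sigma (by simp [LHom.incl]))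

/-- The horizontal part of `m` is an isomorphism of `L(X)`, so only the vertical part matters for
the subobject. -/
theorem LHom.mk_eq_mk_incl {A B : LCat X} (m : A ⟶ B) :
    Subobject.mk m = Subobject.mk (LHom.incl (LHom.le m)) :=
  Subobject.mk_eq_mk_of_comm _ _ (LHom.isoOf (LHom.hom m))
    ((LHom.isoOf_hom_comp _ _).trans (LHom.ext_sigma (by simp [LHom.incl])))

theorem exists_sub_eq_mk_incl {B : LCat X} (S : Subobject B) :
    ∃ (D : X) (h : ObLE D B.of), S = Subobject.mk (LHom.incl h) :=
  ⟨_, _, (Subobject.mk_arrow S).symm.trans (LHom.mk_eq_mk_incl S.arrow)⟩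

theorem kappaObj_mk_incl {D : X} {B : LCat X} (h : ObLE D B.of) :
    kappaObj ⟨B, Subobject.mk (LHom.incl h)⟩ = D := rfl

theorem kappaObj_le_base (P : GCat (LCat X)) : ObLE (kappaObj P) P.base.of := by
  obtain ⟨B, S⟩ := P
  obtain ⟨D, h, rfl⟩ := exists_sub_eq_mk_incl S
  exact h

/-- Normal form of a span: transporting the apex along the horizontal part of the left leg turns
that leg into an inclusion, and the horizontal part of the right leg becomes the value of `κ`. -/
theorem SpanClass.exists_eq_mk_incl {B C : LCat X} (q : SpanClass B C) :
    ∃ (D E : X) (g : D ⟶ E) (hD : ObLE D B.of) (hE : ObLE E C.of),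
      q = SpanClass.mk (LHom.incl hD) (⟨E, g, hE⟩ : LHom ⟨D⟩ C) ∧ kappaSpan q = Ar.mk g := by
  induction q using SpanClass.ind with
  | h m n =>
  refine ⟨_, _, Groupoid.inv (LHom.hom m) ≫ LHom.hom n, LHom.le m, LHom.le n, ?_, rfl⟩
  refine SpanClass.mk_eq_mk.2 ⟨LHom.isoOf (LHom.hom m),
    (LHom.isoOf_hom_comp _ _).trans (LHom.ext_sigma ?_),
    (LHom.isoOf_hom_comp _ _).trans (LHom.ext_sigma ?_)⟩
  · simp [LHom.incl]
  · simp

/-- For spans in normal form, the inclusion `D ≤ D'` is the required map of apices: followed by the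
right leg of `q'` it gives the restriction of `g'` to `D`, which is `g`. -/
theorem SpanClass.le_of_kappaSpan_le {B C : LCat X} {q q' : SpanClass B C}
    (h : kappaSpan q ≤ kappaSpan q') : q ≤ q' := by
  obtain ⟨D, E, g, hD, hE, hq, hg⟩ := q.exists_eq_mk_incl
  obtain ⟨D', E', g', hD', hE', hq', hg'⟩ := q'.exists_eq_mk_incl
  rw [hg, hg'] at h
  rw [hq, hq']
  exact SpanClass.mk_le_mk.2 ⟨LHom.incl (B := ⟨D'⟩) (obLE_dom h),
    LHom.incl_comp _ (LHom.incl hD') (𝟙 D) (obLE_dom h), LHom.incl_comp _ _ g h⟩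

/-- The bases must be compared separately, since `κ` forgets them while the order of `GL(X)` relates
only arrows with equal bases. -/
theorem GHom.le_of_kappaMap_le {P Q P' Q' : GCat (LCat X)} {f : P ⟶ Q} {f' : P' ⟶ Q'}
    (hP : P.base = P'.base) (hQ : Q.base = Q'.base)
    (h : Ar.mk (kappaMap f) ≤ Ar.mk (kappaMap f')) : Ar.mk f ≤ Ar.mk f' := by
  obtain ⟨B, S⟩ := P
  obtain ⟨B', S'⟩ := P'
  obtain ⟨C, T⟩ := Q
  obtain ⟨C', T'⟩ := Q'
  dsimp only at hP hQ
  subst hP hQ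
  rw [mk_kappaMap, mk_kappaMap] at h
  exact arToSpan_le_iff.2 (SpanClass.le_of_kappaSpan_le h)

theorem kappaMap_id (P : GCat (LCat X)) : kappaMap (𝟙 P) = 𝟙 (kappaObj P) := (kappa X).map_id P

theorem GCat.base_eq_of_le {P Q : GCat (LCat X)} (h : ObLE P Q) : P.base = Q.base :=
  (arToSpan_le h).1

theorem GCat.le_iff {P Q : GCat (LCat X)} :
    ObLE P Q ↔ P.base = Q.base ∧ ObLE (kappaObj P) (kappaObj Q) := by
  refine ⟨fun h => ⟨GCat.base_eq_of_le h, ?_⟩, fun h => GHom.le_of_kappaMap_le h.1 h.1 ?_⟩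
  · have := (kappa X).monotone h
    rwa [(kappa X).map_id, (kappa X).map_id] at this
  · rw [kappaMap_id, kappaMap_id]
    exact h.2

theorem GCat.ext_kappaObj {P Q : GCat (LCat X)} (h : P.base = Q.base)
    (h' : kappaObj P = kappaObj Q) : P = Q :=
  (GCat.le_iff.2 ⟨h, h' ▸ ObLE.refl _⟩).antisymm (GCat.le_iff.2 ⟨h.symm, h' ▸ ObLE.refl _⟩)

/-- Fullness of `κ`. Once `P` and `Q` are written as inclusions `D ≤ B` and `E ≤ C`, the arrow `g :
D ⟶ E` is itself the horizontal part of the right leg of a span with apex `D`. -/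
theorem exists_kappaMap_eq (P Q : GCat (LCat X)) (a : Ar X) (hd : kappaObj P = a.dom)
    (hc : kappaObj Q = a.cod) : ∃ f : P ⟶ Q, Ar.mk (kappaMap f) = a := by
  obtain ⟨B, S⟩ := P
  obtain ⟨C, T⟩ := Q
  obtain ⟨D, h, rfl⟩ := exists_sub_eq_mk_incl S
  obtain ⟨E, h', rfl⟩ := exists_sub_eq_mk_incl T
  rcases a with @⟨D', E', g⟩
  rw [kappaObj_mk_incl] at hd hc
  dsimp only at hd hc
  subst hd hc
  let f : (⟨B, Subobject.mk (LHom.incl h)⟩ : GCat (LCat X)) ⟶ ⟨C, Subobject.mk (LHom.incl h')⟩ :=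
    (⟨SpanClass.mk (LHom.incl h) (⟨E, g, h'⟩ : LHom ⟨D⟩ C), rfl,
      LHom.mk_eq_mk_incl (A := ⟨D⟩) (B := C) (⟨E, g, h'⟩ : LHom ⟨D⟩ C)⟩ :
      GHom ⟨B, Subobject.mk (LHom.incl h)⟩ ⟨C, Subobject.mk (LHom.incl h')⟩)
  refine ⟨f, (mk_kappaMap f).trans ?_⟩
  change Ar.mk (Groupoid.inv (𝟙 D) ≫ g) = _
  simp

end

/-! ### Fully faithful double functors between posets -/

/-- By `hle` the maps `f`, `s`, `t` jointly reflect the order, and by `hex` they reach every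
compatible triple. So `A` is isomorphic, as a poset, to the pullback. -/
theorem isPullback_prod_poset {A B A₀ B₀ : Type u} [PartialOrder A] [PartialOrder B]
    [PartialOrder A₀] [PartialOrder B₀] {f : A → B} {f₀ : A₀ → B₀} {s t : A → A₀} {s' t' : B → B₀}
    (hf : Monotone f) (hf₀ : Monotone f₀) (hs : Monotone s) (ht : Monotone t)
    (hs' : Monotone s') (ht' : Monotone t') (ws : ∀ a, s' (f a) = f₀ (s a))
    (wt : ∀ a, t' (f a) = f₀ (t a))
    (hle : ∀ {a a'}, f a ≤ f a' → s a ≤ s a' → t a ≤ t a' → a ≤ a')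
    (hex : ∀ b x y, s' b = f₀ x → t' b = f₀ y → ∃ a, f a = b ∧ s a = x ∧ t a = y) :
    IsPullback (monoHom f hf) (prod.lift (monoHom s hs) (monoHom t ht))
      (prod.lift (monoHom s' hs') (monoHom t' ht')) (prod.map (monoHom f₀ hf₀) (monoHom f₀ hf₀)) := by
  have hinj : ∀ {a a'}, f a = f a' → s a = s a' → t a = t a' → a = a' := fun h h₁ h₂ =>
    (hle h.le h₁.le h₂.le).antisymm (hle h.ge h₁.ge h₂.ge)
  have key : ∀ {T : Cat.{u, u}} (b : T ⟶ Cat.of B) (x y : T ⟶ Cat.of A₀),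
      b ≫ monoHom s' hs' = x ≫ monoHom f₀ hf₀ → b ≫ monoHom t' ht' = y ≫ monoHom f₀ hf₀ →
      ∃ a : T ⟶ Cat.of A, a ≫ monoHom f hf = b ∧ a ≫ monoHom s hs = x ∧ a ≫ monoHom t ht = y := by
    intro T b x y h₁ h₂
    have H := fun z : T => hex ((toPoset b).obj z) ((toPoset x).obj z) ((toPoset y).obj z)
      (Functor.congr_obj (congrArg Cat.Hom.toFunctor h₁) z)
      (Functor.congr_obj (congrArg Cat.Hom.toFunctor h₂) z)
    -- Objectwise choices form a functor because order reflection makes them monotone.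
    choose a ha using H
    let F : T ⥤ A :=
      { obj := a
        map := fun {z z'} k => homOfLE (hle
          (by rw [(ha z).1, (ha z').1]; exact leOfHom ((toPoset b).map k))
          (by rw [(ha z).2.1, (ha z').2.1]; exact leOfHom ((toPoset x).map k))
          (by rw [(ha z).2.2, (ha z').2.2]; exact leOfHom ((toPoset y).map k)))
        map_id := fun _ => Subsingleton.elim _ _
        map_comp := fun _ _ => Subsingleton.elim _ _ }
    exact ⟨F.toCatHom, cat_hom_ext fun z => (ha z).1, cat_hom_ext fun z => (ha z).2.1,
      cat_hom_ext fun z => (ha z).2.2⟩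
  have hom_ext : ∀ {T : Cat.{u, u}} {a a' : T ⟶ Cat.of A},
      a ≫ monoHom f hf = a' ≫ monoHom f hf → a ≫ monoHom s hs = a' ≫ monoHom s hs →
      a ≫ monoHom t ht = a' ≫ monoHom t ht → a = a' := fun h h₁ h₂ => cat_hom_ext fun z =>
    hinj (Functor.congr_obj (congrArg Cat.Hom.toFunctor h) z)
      (Functor.congr_obj (congrArg Cat.Hom.toFunctor h₁) z)
      (Functor.congr_obj (congrArg Cat.Hom.toFunctor h₂) z)
  have hws : monoHom f hf ≫ monoHom s' hs' = monoHom s hs ≫ monoHom f₀ hf₀ := cat_hom_ext ws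
  have hwt : monoHom f hf ≫ monoHom t' ht' = monoHom t ht ≫ monoHom f₀ hf₀ := cat_hom_ext wt
  refine ⟨⟨by rw [prod.comp_lift, hws, hwt, prod.lift_map]⟩, ⟨PullbackCone.isLimitAux' _ ?_⟩⟩
  intro c
  have hc := c.condition
  have h₁ := congrArg (· ≫ prod.fst) hc
  have h₂ := congrArg (· ≫ prod.snd) hc
  simp only [Category.assoc, prod.lift_fst, prod.lift_snd, prod.map_fst, prod.map_snd] at h₁ h₂
  have H := key c.fst (c.snd ≫ prod.fst) (c.snd ≫ prod.snd)
    (by rw [h₁, Category.assoc]) (by rw [h₂, Category.assoc])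
  obtain ⟨a₁, a₂, a₃⟩ := H.choose_spec
  refine ⟨H.choose, a₁, ?_, fun {m} m₁ m₂ => hom_ext (m₁.trans a₁.symm) ?_ ?_⟩
  · refine prod.hom_ext ?_ ?_
    · exact (Category.assoc _ _ _).trans ((congrArg _ (prod.lift_fst _ _)).trans a₂)
    · exact (Category.assoc _ _ _).trans ((congrArg _ (prod.lift_snd _ _)).trans a₃)
  · rw [a₂, ← m₂]
    exact ((Category.assoc _ _ _).trans (congrArg _ (prod.lift_fst _ _))).symm
  · rw [a₃, ← m₂]
    exact ((Category.assoc _ _ _).trans (congrArg _ (prod.lift_snd _ _))).symm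

theorem isFullyFaithful_kappa (X : Type u) [OrderedGroupoid X] :
    (kappa X).toDoubleFunctor.IsFullyFaithful := by
  refine isPullback_prod_poset _ _ _ _ _ _ (fun _ => rfl) (fun _ => rfl) ?_ ?_
  · intro a a' h h₁ h₂
    exact GHom.le_of_kappaMap_le (GCat.base_eq_of_le h₁) (GCat.base_eq_of_le h₂) h
  · intro b x y hx hy
    obtain ⟨f, hf⟩ := exists_kappaMap_eq x.of y.of b (congrArg VOb.of hx).symm
      (congrArg VOb.of hy).symm
    exact ⟨Ar.mk f, hf, rfl, rfl⟩

/-! ### The functor `κ` is essentially surjective -/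

/-- Needed because essential surjectivity refers to the chosen `pullback`, which is only isomorphic
to the explicit `PosetPullback`. -/
theorem IsDiscreteFibration.of_iso {P : Type u} [PartialOrder P] {E E' : Cat.{u, u}} (i : E' ≅ E)
    {p : E ⟶ Cat.of P} {p' : E' ⟶ Cat.of P} (h : i.hom ≫ p = p')
    (hp : IsDiscreteFibration (toPoset p')) : IsDiscreteFibration (toPoset p) := by
  have hi : ∀ e, i.hom.toFunctor.obj (i.inv.toFunctor.obj e) = e := fun e =>
    Functor.congr_obj (congrArg Cat.Hom.toFunctor i.inv_hom_id) e
  have hobj : ∀ e, (toPoset p).obj (i.hom.toFunctor.obj e) = (toPoset p').obj e := fun e =>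
    Functor.congr_obj (congrArg Cat.Hom.toFunctor h) e
  have hobj' : ∀ e, (toPoset p').obj (i.inv.toFunctor.obj e) = (toPoset p).obj e := fun e => by
    rw [← hobj, hi]
  refine ⟨fun f g => ?_, fun e b hb => ?_, fun {e a b} f g hab => ?_⟩
  · exact (Cat.equivOfIso i).inverse.map_injective (hp.thin _ _)
  · obtain ⟨e', he', ⟨l⟩⟩ := hp.exists_lift (i.inv.toFunctor.obj e) b (by rwa [hobj'])
    exact ⟨i.hom.toFunctor.obj e', (hobj e').trans he', ⟨i.hom.toFunctor.map l ≫ eqToHom (hi e)⟩⟩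
  · have := hp.lift_unique (i.inv.toFunctor.map f) (i.inv.toFunctor.map g) (by rw [hobj', hobj', hab])
    rw [← hi a, this, hi]

section

variable (X : Type u) [OrderedGroupoid X]

/-- The functor on objects of `κ`, with values in a poset. -/
abbrev kappaVOb : Cat.of (VOb (GCat (LCat X))) ⟶ Cat.of (VOb X) :=
  (kappa X).toDoubleFunctor.F₀

/-- The target functor on the category of pairs of an object `P` of `GL(X)` and an arrow of `X` with
domain `κ P`. -/
def kappaTarget : Cat.of (PosetPullback (toPoset (kappaVOb X)) (toPoset (sHom X))) ⟶
    Cat.of (VOb X) :=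
  (PosetPullback.sndFunctor (toPoset (kappaVOb X)) (toPoset (sHom X))).toCatHom ≫ tHom X

theorem isDiscreteFibration_kappaTarget : IsDiscreteFibration (toPoset (kappaTarget X)) where
  thin f g := Prod.ext (posetHom_eq (P := VOb (GCat (LCat X))) _ _) (posetHom_eq (P := Ar X) _ _)
  exists_lift := by
    rintro ⟨⟨P⟩, @⟨A, B, a⟩, hw⟩ ⟨B'⟩ (h : ObLE B' B)
    have hP : kappaObj P = A := congrArg VOb.of hw
    -- Restriction acts on domains, so a restriction on the codomain of `a` passes through the
    -- inverse.
    let r := res (Groupoid.inv a) h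
    have hr : Ar.mk (Groupoid.inv r) ≤ Ar.mk a := by
      simpa using OrderedGroupoid.inv_le (res_le (Groupoid.inv a) h)
    have hD : ObLE (resCod (Groupoid.inv a) h) (kappaObj P) := by
      rw [hP]
      exact obLE_dom hr
    refine ⟨⟨⟨⟨P.base, Subobject.mk (LHom.incl (hD.trans (kappaObj_le_base P)))⟩⟩,
      Ar.mk (Groupoid.inv r), rfl⟩, rfl, ⟨(homOfLE (X := VOb _) ?_, homOfLE (X := Ar X) hr)⟩⟩
    exact GCat.le_iff.2 ⟨rfl, hD⟩
  lift_unique := by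
    rintro ⟨⟨P⟩, a, hw⟩ ⟨⟨P₁⟩, @⟨A₁, B₁, a₁⟩, hw₁⟩ ⟨⟨P₂⟩, @⟨A₂, B₂, a₂⟩, hw₂⟩ f g h
    obtain rfl : B₁ = B₂ := congrArg VOb.of h
    have h₁ : Ar.mk a₁ ≤ a := leOfHom (X := Ar X) f.2
    have h₂ : Ar.mk a₂ ≤ a := leOfHom (X := Ar X) g.2
    -- The order of `GL(X)` keeps the base fixed, so `P₁` and `P₂` can differ only in their values
    -- under `κ`. Those are the domains of `a₁` and `a₂`, which agree by unique restriction of the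
    -- inverse of `a`.
    have hb₁ : P₁.base = P.base := GCat.base_eq_of_le (leOfHom (X := VOb _) f.1)
    have hb₂ : P₂.base = P.base := GCat.base_eq_of_le (leOfHom (X := VOb _) g.1)
    have hinv := res_unique _ _ (OrderedGroupoid.inv_le h₁) (OrderedGroupoid.inv_le h₂)
    obtain ⟨rfl, e⟩ := Sigma.mk.inj hinv
    obtain rfl : a₁ = a₂ := by
      have e := eq_of_heq e
      rw [Groupoid.inv_eq_inv, Groupoid.inv_eq_inv] at e
      exact IsIso.inv_eq_inv.1 e
    obtain rfl : P₁ = P₂ := GCat.ext_kappaObj (hb₁.trans hb₂.symm)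
      ((congrArg VOb.of hw₁).trans (congrArg VOb.of hw₂).symm)
    rfl

theorem isEssentiallySurjective_kappa : (kappa X).toDoubleFunctor.IsEssentiallySurjective := by
  have hpb := isPullback_posetPullback (kappaVOb X) (sHom X)
  have h : hpb.isoPullback.hom ≫ pullback.snd (kappaVOb X) (sHom X) ≫ tHom X = kappaTarget X :=
    (Category.assoc _ _ _).symm.trans (congrArg (· ≫ tHom X) hpb.isoPullback_hom_snd)
  refine IsDiscreteFibration.isEffectiveDescent (P := VOb X)
    (.of_iso hpb.isoPullback h (isDiscreteFibration_kappaTarget X)) ?_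
  intro B
  -- The preimage of `B` is the maximal subobject `B ≤ B` paired with the identity of `B`.
  let e : PosetPullback (toPoset (kappaVOb X)) (toPoset (sHom X)) :=
    ⟨⟨⟨⟨B.of⟩, Subobject.mk (LHom.incl (ObLE.refl B.of))⟩⟩, Ar.mk (𝟙 B.of), rfl⟩
  exact ⟨hpb.isoPullback.hom.toFunctor.obj e,
    Functor.congr_obj (congrArg Cat.Hom.toFunctor h) e⟩

end

end

/-- For every (small) ordered groupoid `X`, the double functor `κ : GL(X) ⟶ X` is a weak
equivalence of double categories, i.e. of internal categories in `Cat`. -/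
theorem mainTheorem3 (X : Type u) [OrderedGroupoid X] :
    (kappa X).toDoubleFunctor.IsWeakEquivalence := by
  exact ⟨isEssentiallySurjective_kappa X, isFullyFaithful_kappa X⟩
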